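/- Let $p\ge 5$ be a prime, $\mathbb F$ a finite field of characteristic $p$ and $r\ge 1$. Let $K_1=\{g\in \mathrm{GL}_2(\mathbb Z_p): g\equiv 1 \bmod p\}$, let $Z_1$ be the subgroup of scalar matrices in $K_1$, and for $n\ge 1$ let \[T_1(p^n)=\begin{pmatrix}1+p\mathbb Z_p & p^n\mathbb Z_p\\ p^n\mathbb Z_p & 1+p\mathbb Z_p\end{pmatrix}\subset K_1 .\] Put $\mathscr K_1=\prod_{i=1}^r K_1$, $\mathscr Z_1=\prod_{i=1}^r Z_1$, $\Lambda=\mathbb F[[\mathscr K_1/\mathscr Z_1]]=\varprojlim_N \mathbb F[(\mathscr K_1/\mathscr Z_1)/N]$ ($N$ running over the open normal subgroups) and, for $\mathbf n=(n_1,\dots,n_r)\in(\mathbb Z_{\ge 1})^r$, $\mathscr T_1(p^{\mathbf n})=\prod_{i=1}^r T_1(p^{n_i})$ and $\kappa(\mathbf n)=\max_i n_i$. For a $\Lambda$-module $N$, let $N_{\mathscr T_1(p^{\mathbf n})}$ be the space of coinvariants, i.e. the quotient of $N$ by the $\mathbb F$-span of all $t\cdot x-x$ with $t\in\mathscr T_1(p^{\mathbf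 n})$ and $x\in N$. For functions $f,g\ge 0$ of $\mathbf n$, write $f\ll g$ if there is a constant $C$ with $f(\mathbf n)\le C g(\mathbf n)$ for all $\mathbf n\in(\mathbb Z_{\ge1})^r$, and $f\sim g$ if $f\ll g$ and $g\ll f$. Let $M$ be a finitely generated $\Lambda$-module and $\phi\in\mathrm{End}_\Lambda(M)$ with $\bigcap_{k\ge 1}\phi^k(M)=0$. Then all the spaces $M_{\mathscr T_1(p^{\mathbf n})}$ are finite dimensional over $\mathbb F$, and the following hold (the implied constants do not depend on $\mathbf n$). (i) If $\phi$ is nilpotent, then $\dim_{\mathbb F}M_{\mathscr T_1(p^{\mathbf n})}\sim \dim_{\mathbb F}\big(M/\phi(M)\big)_{\mathscr T_1(p^{\mathbf n})}$. (ii) If $\phi$ is not nilpotent, then for every sufficiently large $k_0$ \[\dim_{\mathbb F}M_{\mathscr T_1(p^{\mathbf n})}\ll \max\Big\{\dim_{\mathbb F}\big(M/\phi(M)\big)_{\mathscr T_1(p^{\mathbf n})},\ p^{\kappa(\mathbf n)}\dim_{\mathbb F}\big(\phi^{k_0}(M)/\phi^{k_0+1}(M)\big)_{\mathscr T_1(p^{\mathbf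 n})}\Big\}.\] In any case, $\dim_{\mathbb F}M_{\mathscr T_1(p^{\mathbf n})}\ll p^{\kappa(\mathbf n)}\dim_{\mathbb F}\big(M/\phi(M)\big)_{\mathscr T_1(p^{\mathbf n})}$. -/

import Mathlib

open scoped MatrixGroups

noncomputable section

/-! ### Completed group algebras -/

/-- The completed group algebra `F[[G]] = lim F[G/N]`, the limit being taken over the open normal
subgroups `N` of `G`: the compatible families in the product of the group algebras `F[G/N]`. -/
def completedGroupAlgebra (F : Type*) [Field F] (G : Type*) [Group G] [TopologicalSpace G] :
    Subalgebra F (∀ N : OpenNormalSubgroup G, MonoidAlgebra F (G ⧸ N.toSubgroup)) where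
  carrier := {x | ∀ (N N' : OpenNormalSubgroup G) (h : N.toSubgroup ≤ N'.toSubgroup),
    MonoidAlgebra.mapDomainAlgHom F F
      (QuotientGroup.map N.toSubgroup N'.toSubgroup (MonoidHom.id G) h) (x N) = x N'}
  mul_mem' {x y} hx hy N N' h := by
    simp only [Pi.mul_apply, map_mul, hx N N' h, hy N N' h]
  add_mem' {x y} hx hy N N' h := by
    simp only [Pi.add_apply, map_add, hx N N' h, hy N N' h]
  algebraMap_mem' a N N' h := by
    simp only [Pi.algebraMap_apply, AlgHom.commutes]

/-- The canonical homomorphism `G → F[[G]]`, `g ↦ [g]`. -/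
def completedGroupAlgebra.of (F : Type*) [Field F] (G : Type*) [Group G] [TopologicalSpace G] :
    G →* completedGroupAlgebra F G where
  toFun g := ⟨fun N => MonoidAlgebra.of F (G ⧸ N.toSubgroup) (QuotientGroup.mk g), by
    intro N N' h
    simp only [MonoidAlgebra.of_apply, MonoidAlgebra.mapDomainAlgHom_apply,
      MonoidAlgebra.mapDomain_single]
    rfl⟩
  map_one' := by
    ext1; funext N
    exact map_one (MonoidAlgebra.of F (G ⧸ N.toSubgroup))
  map_mul' g h := by
    ext1; funext N
    exact map_mul (MonoidAlgebra.of F (G ⧸ N.toSubgroup)) (QuotientGroup.mk g) (QuotientGroup.mk h)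

/-! ### The groups -/

/-- For `n ≥ 1`, the subgroup `T₁(pⁿ)` of `GL₂(ℤ_p)` of the matrices whose diagonal entries lie in
`1 + pℤ_p` and whose off-diagonal entries lie in `pⁿℤ_p`. -/
def T1 (p : ℕ) [Fact p.Prime] (n : ℕ+) : Subgroup (GL (Fin 2) ℤ_[p]) where
  carrier := {g | (p : ℤ_[p]) ∣ g 0 0 - 1 ∧ (p : ℤ_[p]) ^ (n : ℕ) ∣ g 0 1 ∧
    (p : ℤ_[p]) ^ (n : ℕ) ∣ g 1 0 ∧ (p : ℤ_[p]) ∣ g 1 1 - 1}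
  one_mem' := by simp
  mul_mem' {g h} := by
    rintro ⟨⟨a, ha⟩, ⟨b, hb⟩, ⟨c, hc⟩, ⟨d, hd⟩⟩ ⟨⟨a', ha'⟩, ⟨b', hb'⟩, ⟨c', hc'⟩, ⟨d', hd'⟩⟩
    obtain ⟨m, hm⟩ : ∃ m, (n : ℕ) = m + 1 := ⟨(n : ℕ) - 1, by have := n.pos; omega⟩
    rw [sub_eq_iff_eq_add] at ha hd ha' hd'
    simp only [Set.mem_ofPred_eq, Units.val_mul, Matrix.mul_apply, Fin.sum_univ_two]
    rw [ha, hb, hc, hd, ha', hb', hc', hd']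
    refine ⟨⟨a * a' * p + a + a' + p ^ m * b * (p ^ (n : ℕ) * c'), ?_⟩,
      ⟨(p * a + 1) * b' + b * (p * d' + 1), by ring⟩,
      ⟨c * (p * a' + 1) + (p * d + 1) * c', by ring⟩,
      ⟨d * d' * p + d + d' + p ^ m * c * (p ^ (n : ℕ) * b'), ?_⟩⟩ <;>
    · rw [hm]; ring
  inv_mem' {g} := by
    rintro ⟨ha, hb, hc, hd⟩
    have hp : (p : ℤ_[p]) ∣ (p : ℤ_[p]) ^ (n : ℕ) := dvd_pow_self _ n.ne_zero
    have key : (g : Matrix (Fin 2) (Fin 2) ℤ_[p]) * ((g⁻¹ : GL (Fin 2) ℤ_[p]) :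
        Matrix (Fin 2) (Fin 2) ℤ_[p]) = 1 := by
      rw [← Units.val_mul, mul_inv_cancel, Units.val_one]
    have h00 := congrFun (congrFun key 0) 0
    have h11 := congrFun (congrFun key 1) 1
    simp only [Matrix.mul_apply, Fin.sum_univ_two, Matrix.one_apply_eq] at h00 h11
    have hinv : ((g⁻¹ : GL (Fin 2) ℤ_[p]) : Matrix (Fin 2) (Fin 2) ℤ_[p]) =
        Ring.inverse (g : Matrix (Fin 2) (Fin 2) ℤ_[p]).det •
          (g : Matrix (Fin 2) (Fin 2) ℤ_[p]).adjugate := by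
      rw [Matrix.coe_units_inv, Matrix.inv_def]
    refine ⟨?_, ?_, ?_, ?_⟩
    · have e : (g⁻¹ : GL (Fin 2) ℤ_[p]) 0 0 - 1 =
          -((g 0 0 - 1) * (g⁻¹ : GL (Fin 2) ℤ_[p]) 0 0 +
            g 0 1 * (g⁻¹ : GL (Fin 2) ℤ_[p]) 1 0) := by linear_combination h00
      rw [e]
      exact (dvd_add (ha.mul_right _) ((hp.trans hb).mul_right _)).neg_right
    · rw [hinv, Matrix.adjugate_fin_two]
      simpa using hb
    · rw [hinv, Matrix.adjugate_fin_two]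
      simpa using hc
    · have e : (g⁻¹ : GL (Fin 2) ℤ_[p]) 1 1 - 1 =
          -(g 1 0 * (g⁻¹ : GL (Fin 2) ℤ_[p]) 0 1 +
            (g 1 1 - 1) * (g⁻¹ : GL (Fin 2) ℤ_[p]) 1 1) := by linear_combination h11
      rw [e]
      exact (dvd_add ((hp.trans hc).mul_right _) (hd.mul_right _)).neg_right

/-- The principal congruence subgroup `K₁` of `GL₂(ℤ_p)`, consisting of the matrices congruent to
the identity modulo `p`. -/
def K1 (p : ℕ) [Fact p.Prime] : Subgroup (GL (Fin 2) ℤ_[p]) :=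
  (Matrix.GeneralLinearGroup.map (n := Fin 2)
    (Ideal.Quotient.mk (Ideal.span {(p : ℤ_[p])}))).ker

/-- The subgroup `Z₁` of scalar matrices in `K₁`. -/
def Z1 (p : ℕ) [Fact p.Prime] : Subgroup (K1 p) :=
  (Subgroup.center (GL (Fin 2) ℤ_[p])).subgroupOf (K1 p)

instance Z1.normal (p : ℕ) [Fact p.Prime] : (Z1 p).Normal := by
  unfold Z1; infer_instance

/-- The product `𝒦₁` of `r` copies of `K₁`. -/
abbrev ProdK1 (p : ℕ) [Fact p.Prime] (r : ℕ) : Type := Fin r → K1 p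

/-- The product `𝒵₁` of `r` copies of `Z₁`. -/
def ProdZ1 (p : ℕ) [Fact p.Prime] (r : ℕ) : Subgroup (ProdK1 p r) :=
  Subgroup.pi Set.univ fun _ => Z1 p

instance ProdZ1.normal (p : ℕ) [Fact p.Prime] (r : ℕ) : (ProdZ1 p r).Normal where
  conj_mem x hx g i hi := (Z1.normal p).conj_mem (x i) (hx i hi) (g i)

/-- The subgroup `𝒯₁(pⁿ) = ∏ᵢ T₁(p^{nᵢ})` of `𝒦₁`, for `n = (n₁, …, n_r)` with all `nᵢ ≥ 1`. -/
def ProdT1 (p : ℕ) [Fact p.Prime] {r : ℕ} (n : Fin r → ℕ+) : Subgroup (ProdK1 p r) :=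
  Subgroup.pi Set.univ fun i => (T1 p (n i)).subgroupOf (K1 p)

/-- `κ(n) = maxᵢ nᵢ`. -/
def kappa {r : ℕ} (n : Fin r → ℕ+) : ℕ := Finset.univ.sup fun i => (n i : ℕ)

/-- The Iwasawa algebra `Λ = F[[𝒦₁/𝒵₁]]`. -/
abbrev Lam (F : Type*) [Field F] (p : ℕ) [Fact p.Prime] (r : ℕ) :=
  completedGroupAlgebra F (ProdK1 p r ⧸ ProdZ1 p r)

/-! ### Coinvariants -/

section

variable (F : Type*) [Field F] (p : ℕ) [Fact p.Prime] {r : ℕ}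
  (M : Type*) [AddCommGroup M] [Module F M] [Module (Lam F p r) M]
  [IsScalarTower F (Lam F p r) M]

/-- The action of `𝒦₁` on a `Λ`-module, `g` acting by `[g mod 𝒵₁] ∈ Λ`. -/
def prodK1Rep : Representation F (ProdK1 p r) M :=
  ((Algebra.lsmul F F M : Lam F p r →ₐ[F] Module.End F M) : Lam F p r →* Module.End F M).comp
    ((completedGroupAlgebra.of F (ProdK1 p r ⧸ ProdZ1 p r)).comp
      (QuotientGroup.mk' (ProdZ1 p r)))

/-- The coinvariants `M_{𝒯₁(pⁿ)}` of a `Λ`-module `M`: the quotient of `M` by the `F`-span of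
the elements `t • m - m` with `t ∈ 𝒯₁(pⁿ)` and `m ∈ M`. -/
abbrev coinv (n : Fin r → ℕ+) : Type _ :=
  Representation.Coinvariants ((prodK1Rep F p (r := r) M).comp (ProdT1 p n).subtype)

/-- The dimension over `F` of the coinvariants `M_{𝒯₁(pⁿ)}`. -/
def dimCoinv (n : Fin r → ℕ+) : ℕ := Module.finrank F (coinv F p M n)

end

/-! ### Growth -/

/-- `f ≪ g`: there is a constant `C` such that `f n ≤ C g n` for every `n`. -/
def Dominated {ι : Type*} (f g : ι → ℕ) : Prop := ∃ C : ℕ, ∀ n, f n ≤ C * g n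

/-- `f ∼ g`: `f ≪ g` and `g ≪ f`. -/
def Comparable {ι : Type*} (f g : ι → ℕ) : Prop := Dominated f g ∧ Dominated g f

/-- The graded piece `φᵏ(M)/φᵏ⁺¹(M)`. -/
abbrev gradedPiece {R M : Type*} [Ring R] [AddCommGroup M] [Module R M] (φ : Module.End R M)
    (k : ℕ) : Type _ :=
  ↥(LinearMap.range (φ ^ k)) ⧸
    (LinearMap.range (φ ^ (k + 1))).submoduleOf (LinearMap.range (φ ^ k))

end

/-!
Let `Uₛ` be the image in `𝒦₁/𝒵₁` of the principal congruence subgroup of level `p ^ (2 + s)`, and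
let `J` be the kernel of `F[[𝒦₁/𝒵₁]] → F[(𝒦₁/𝒵₁)/U₀]`. The elements `1 + p ^ 2 E` (`E` elementary
in one factor) and their `p ^ s`-th powers generate `U₀` and `Uₛ` topologically, and the commutators
of the former lie in `U₂`. Modulo `Uₛ` a product of `4 r (p ^ s - 1) + 1` of the differences
`[g] - 1` can therefore be reordered, up to terms of higher degree, so that some `p ^ s`-th power
`([g] - 1) ^ p ^ s = 0` occurs in it. Since the augmentation ideal of a finite `p`-group in
characteristic `p` is nilpotent, `J ^ (c p ^ s)` lies in the right ideal generated by the `[t] - 1`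
with `t ∈ Uₛ`, where `c = 4 r + 1`. For `s = κ(n)` these `t` come from `𝒯₁(pⁿ)`.

By compactness, `⋂ φᵏ(M) = 0` implies `φᵏ(M) ⊆ J M` for some `k`, so that `φ ^ (k c p ^ κ(n))` kills
the coinvariants of `M`. The cokernel of an endomorphism with vanishing `m`-th power has at least
`1 / m` of the dimension, whence the last bound. Applied to `φᵏ(M)` instead
of `M`, the same bound gives the second one, as `dim M_𝒯` exceeds `dim φᵏ(M)_𝒯` by at most
`k dim (M/φ(M))_𝒯`.
-/

open scoped commutatorElement

section NilpotencyOfPowers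

variable {F R : Type*} [CommSemiring F] [Ring R] [Algebra F R]

lemma list_prod_mem_pow_length {J : Submodule F R} {l : List R} (hl : ∀ x ∈ l, x ∈ J) :
    l.prod ∈ J ^ l.length := by
  induction l with
  | nil => simpa using Submodule.one_le.mp (le_refl (1 : Submodule F R))
  | cons x l ih =>
    rw [List.prod_cons, List.length_cons, pow_succ']
    exact Submodule.mul_mem_mul (hl x (by simp)) (ih fun y hy => hl y (by simp [hy]))

lemma list_prod_sub_prod_mem_pow_of_perm {J : Submodule F R} {X : Set R} (hX : X ⊆ J)
    (hcomm : ∀ x ∈ X, ∀ y ∈ X, x * y - y * x ∈ J ^ 3) {l₁ l₂ : List R} (h : l₁.Perm l₂)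
    (hl : ∀ x ∈ l₁, x ∈ X) : l₁.prod - l₂.prod ∈ J ^ (l₁.length + 1) := by
  induction h with
  | nil => simp
  | cons x _ ih =>
    rw [List.prod_cons, List.prod_cons, ← mul_sub, List.length_cons, pow_succ']
    exact Submodule.mul_mem_mul (hX (hl x (by simp))) (ih fun y hy => hl y (by simp [hy]))
  | swap x y l =>
    have hswap : (y :: x :: l).prod - (x :: y :: l).prod = (y * x - x * y) * l.prod := by
      simp only [List.prod_cons]; noncomm_ring
    have hlength : (y :: x :: l).length + 1 = 3 + l.length := by simp; omega
    rw [hswap, hlength, pow_add]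
    exact Submodule.mul_mem_mul (hcomm y (hl y (by simp)) x (hl x (by simp)))
      (list_prod_mem_pow_length fun z hz => hX (hl z (by simp [hz])))
  | @trans l₁ l₂ l₃ h₁ _ ih₁ ih₂ =>
    have h₂₃ := ih₂ fun x hx => hl x (h₁.mem_iff.mpr hx)
    rw [← h₁.length_eq] at h₂₃
    simpa only [sub_add_sub_cancel] using Submodule.add_mem _ (ih₁ hl) h₂₃

lemma exists_le_count_of_card_mul_pred_lt_length {ι : Type*} [Fintype ι] [DecidableEq ι]
    {q : ℕ} {l : List ι} (hl : Fintype.card ι * (q - 1) < l.length) : ∃ i, q ≤ l.count i := by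
  by_contra! h
  have hsum : ∑ i, l.count i = l.length := by
    simpa using Multiset.sum_count_eq_card (s := Finset.univ) (m := (l : Multiset ι)) (by simp)
  have hle : ∑ i, l.count i ≤ ∑ _i : ι, (q - 1) :=
    Finset.sum_le_sum fun i _ => Nat.le_sub_one_of_lt (h i)
  rw [Finset.sum_const, Finset.card_univ, smul_eq_mul] at hle
  omega

lemma pow_le_span_pow_sup_pow_succ {J : Submodule F R} {X : Set R} (hX : X ⊆ J)
    (hJ : J ≤ Submodule.span F X ⊔ J ^ 2) (a : ℕ) :
    J ^ a ≤ Submodule.span F X ^ a ⊔ J ^ (a + 1) := by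
  induction a with
  | zero => simp
  | succ a ih =>
    have hXa : Submodule.span F X ^ a ≤ J ^ a := pow_le_pow_left' (Submodule.span_le.mpr hX) a
    calc J ^ (a + 1) = J * J ^ a := pow_succ' _ _
      _ ≤ J * (Submodule.span F X ^ a ⊔ J ^ (a + 1)) := mul_le_mul_right ih _
      _ = J * Submodule.span F X ^ a ⊔ J ^ (a + 2) := by rw [Submodule.mul_sup, ← pow_succ']
      _ ≤ (Submodule.span F X ⊔ J ^ 2) * Submodule.span F X ^ a ⊔ J ^ (a + 2) :=
        sup_le_sup_right (mul_le_mul_left hJ _) _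
      _ = Submodule.span F X ^ (a + 1) ⊔ (J ^ 2 * Submodule.span F X ^ a ⊔ J ^ (a + 2)) := by
        rw [Submodule.sup_mul, ← pow_succ', sup_assoc]
      _ ≤ Submodule.span F X ^ (a + 1) ⊔ J ^ (a + 2) := by
        refine sup_le_sup_left (sup_le ?_ le_rfl) _
        rw [add_comm a 2, pow_add]
        exact mul_le_mul_right hXa _

/-- By the pigeonhole principle a word of this length in the `x i` repeats some letter `q` times;
reordering the word changes it only in higher degree and makes it vanish. -/
lemma pow_card_mul_pred_add_one_le_pow_succ {ι : Type*} [Fintype ι] {J : Submodule F R}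
    {x : ι → R} {q : ℕ} (hx : ∀ i, x i ∈ J) (hJ : J ≤ Submodule.span F (Set.range x) ⊔ J ^ 2)
    (hcomm : ∀ i j, x i * x j - x j * x i ∈ J ^ 3) (hq : ∀ i, x i ^ q = 0) :
    J ^ (Fintype.card ι * (q - 1) + 1) ≤ J ^ (Fintype.card ι * (q - 1) + 1 + 1) := by
  classical
  have hX : Set.range x ⊆ J := Set.range_subset_iff.mpr hx
  refine (pow_le_span_pow_sup_pow_succ hX hJ _).trans (sup_le ?_ le_rfl)
  rw [Submodule.span_pow, Submodule.span_le]
  intro y hy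
  obtain ⟨f, rfl⟩ := Set.mem_pow.mp hy
  choose g hg using fun i => (f i).2
  have hword : (List.ofFn fun i => (f i : R)) = (List.ofFn g).map x := by
    rw [List.map_ofFn]; congr 1; funext i; exact (hg i).symm
  obtain ⟨i, hi⟩ := exists_le_count_of_card_mul_pred_lt_length (q := q) (l := List.ofFn g) (by simp)
  obtain ⟨l, hl⟩ := (List.replicate_sublist_iff.mpr hi).exists_perm_append
  have hperm := list_prod_sub_prod_mem_pow_of_perm hX
    (by rintro _ ⟨i, rfl⟩ _ ⟨j, rfl⟩; exact hcomm i j) (hl.map x)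
    (by intro y hy; obtain ⟨j, -, rfl⟩ := List.mem_map.mp hy; exact ⟨j, rfl⟩)
  rw [hword]
  simpa [hq] using hperm

end NilpotencyOfPowers

lemma mul_mem_mul_top {F A : Type*} [CommSemiring F] [Semiring A] [Algebra F A]
    {I : Submodule F A} {x : A} (hx : x ∈ I * ⊤) (y : A) : x * y ∈ I * ⊤ := by
  have hxy := Submodule.mul_mem_mul hx (Submodule.mem_top (R := F) (x := y))
  rw [mul_assoc] at hxy
  exact (mul_le_mul_right (le_top (a := ⊤ * ⊤)) I :) hxy

section Augmentation

/-- The span of the elements `σ g - 1`, `g ∈ S`. For the canonical map from a group to its group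
algebra and `S` a subgroup, it is the augmentation ideal of the group algebra of `S`. -/
def augSpan (F : Type*) {P A : Type*} [CommSemiring F] [Monoid P] [Ring A] [Algebra F A]
    (σ : P →* A) (S : Set P) : Submodule F A :=
  Submodule.span F ((fun g => σ g - 1) '' S)

namespace augSpan

section Monoid

variable {F P A : Type*} [CommSemiring F] [Monoid P] [Ring A] [Algebra F A] {σ : P →* A}

lemma sub_one_mem {S : Set P} {g : P} (hg : g ∈ S) : σ g - 1 ∈ augSpan F σ S :=
  Submodule.subset_span ⟨g, hg, rfl⟩

lemma le_iff {S : Set P} {I : Submodule F A} : augSpan F σ S ≤ I ↔ ∀ g ∈ S, σ g - 1 ∈ I :=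
  Submodule.span_le.trans Set.forall_mem_image

lemma range_eq_span {ι : Type*} (e : ι → P) :
    augSpan F σ (Set.range e) = Submodule.span F (Set.range fun i => σ (e i) - 1) := by
  rw [augSpan, ← Set.range_comp]; rfl

lemma mono {S T : Set P} (h : S ⊆ T) : augSpan F σ S ≤ augSpan F σ T :=
  Submodule.span_mono (Set.image_mono h)

lemma comp {Q : Type*} [Monoid Q] (f : Q →* P) (S : Set Q) :
    augSpan F (σ.comp f) S = augSpan F σ (f '' S) := by
  rw [augSpan, augSpan, Set.image_image]
  rfl

lemma map {B : Type*} [Ring B] [Algebra F B] (f : A →ₐ[F] B) (S : Set P) :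
    (augSpan F σ S).map f.toLinearMap = augSpan F ((f : A →* B).comp σ) S := by
  rw [augSpan, Submodule.map_span, augSpan, Set.image_image]
  congr! 2 with g
  simp

end Monoid

variable {F P A : Type*} [CommRing F] [Group P] [Ring A] [Algebra F A] {σ : P →* A}

lemma mul_self_le (T : Subgroup P) : augSpan F σ T * augSpan F σ T ≤ augSpan F σ T := by
  rw [augSpan, Submodule.span_mul_span, Submodule.span_le]
  rintro _ ⟨_, ⟨g, hg, rfl⟩, _, ⟨h, hh, rfl⟩, rfl⟩
  have hexpand : (σ g - 1) * (σ h - 1) = (σ (g * h) - 1) - (σ g - 1) - (σ h - 1) := by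
    rw [map_mul]; noncomm_ring
  beta_reduce
  rw [hexpand]
  exact sub_mem (sub_mem (sub_one_mem (T.mul_mem hg hh)) (sub_one_mem hg)) (sub_one_mem hh)

lemma pow_le_pow (T : Subgroup P) {a b : ℕ} (ha : a ≠ 0) (hab : a ≤ b) :
    augSpan F σ T ^ b ≤ augSpan F σ T ^ a := by
  obtain ⟨c, rfl⟩ := Nat.exists_eq_succ_of_ne_zero ha
  induction b, hab using Nat.le_induction with
  | base => rfl
  | succ b hb ih =>
    obtain ⟨d, rfl⟩ : ∃ d, b = d + 1 := ⟨b - 1, by omega⟩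
    refine le_trans ?_ ih
    rw [pow_succ (augSpan F σ T) (d + 1), pow_succ _ d, mul_assoc]
    exact mul_le_mul_right (mul_self_le T) _

lemma mul_mem_pow {T : Subgroup P} {k : ℕ} (hk : k ≠ 0) {g : P} (hg : g ∈ T) {x : A}
    (hx : x ∈ augSpan F σ T ^ k) : x * σ g ∈ augSpan F σ T ^ k := by
  have hxg := Submodule.mul_mem_mul hx (sub_one_mem (F := F) (σ := σ) hg)
  rw [← pow_succ] at hxg
  have hsum := add_mem (pow_le_pow T hk k.le_succ hxg) hx
  rwa [mul_sub, mul_one, sub_add_cancel] at hsum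

lemma mul_mem_pow_left {T : Subgroup P} {k : ℕ} (hk : k ≠ 0) {g : P} (hg : g ∈ T) {x : A}
    (hx : x ∈ augSpan F σ T ^ k) : σ g * x ∈ augSpan F σ T ^ k := by
  have hgx := Submodule.mul_mem_mul (sub_one_mem (F := F) (σ := σ) hg) hx
  rw [← pow_succ'] at hgx
  have hsum := add_mem (pow_le_pow T hk k.le_succ hgx) hx
  rwa [sub_mul, one_mul, sub_add_cancel] at hsum

lemma sub_one_mem_of_mem_closure {S : Set P} {I : Submodule F A}
    (hI : ∀ g ∈ Subgroup.closure S, ∀ x ∈ I, x * σ g ∈ I) (hS : ∀ g ∈ S, σ g - 1 ∈ I) {g : P}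
    (hg : g ∈ Subgroup.closure S) : σ g - 1 ∈ I := by
  induction hg using Subgroup.closure_induction with
  | mem g hg => exact hS g hg
  | one => rw [map_one, sub_self]; exact zero_mem _
  | mul g h _ hh hgI hhI =>
    have hmul : σ (g * h) - 1 = (σ g - 1) * σ h + (σ h - 1) := by rw [map_mul]; noncomm_ring
    rw [hmul]
    exact add_mem (hI h hh _ hgI) hhI
  | inv g hg hgI =>
    have hinv : σ g⁻¹ - 1 = -((σ g - 1) * σ g⁻¹) := by
      rw [sub_mul, ← map_mul, mul_inv_cancel, map_one]; noncomm_ring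
    rw [hinv]
    exact neg_mem (hI _ (inv_mem hg) _ hgI)

lemma closure_le_mul_top (S : Set P) :
    augSpan F σ (Subgroup.closure S) ≤ augSpan F σ S * ⊤ := by
  refine le_iff.mpr fun g hg => sub_one_mem_of_mem_closure (fun h _ x hx => ?_) (fun h hh => ?_) hg
  · exact mul_mem_mul_top hx _
  · simpa using Submodule.mul_mem_mul (sub_one_mem (F := F) (σ := σ) hh)
      (Submodule.mem_top (R := F) (x := (1 : A)))

lemma closure_le_sup_sq (S : Set P) :
    augSpan F σ (Subgroup.closure S) ≤
      augSpan F σ S ⊔ augSpan F σ (Subgroup.closure S) ^ 2 := by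
  refine le_iff.mpr fun g hg => sub_one_mem_of_mem_closure (fun h hh x hx => ?_)
    (fun h hh => Submodule.mem_sup_left (sub_one_mem hh)) hg
  have hle : augSpan F σ S ⊔ augSpan F σ (Subgroup.closure S) ^ 2 ≤
      augSpan F σ (Subgroup.closure S) :=
    sup_le (mono Subgroup.subset_closure) ((sq _).trans_le (mul_self_le _))
  have hxh := Submodule.mul_mem_mul (hle hx) (sub_one_mem (F := F) (σ := σ) hh)
  rw [← sq] at hxh
  have hsum := add_mem (Submodule.mem_sup_right hxh) hx
  rwa [mul_sub, mul_one, sub_add_cancel] at hsum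

end augSpan

end Augmentation

section PGroup

variable {F P : Type*} [Field F] [Group P] {p : ℕ} [Fact p.Prime] [CharP F p]

lemma exists_ne_zero_forall_apply_eq_of_isPGroup (hP : IsPGroup p P) {V : Type*} [AddCommGroup V]
    [Module F V] [Finite V] [Nontrivial V] (ρ : Representation F P V) :
    ∃ v : V, v ≠ 0 ∧ ∀ g, ρ g v = v := by
  let _ : MulAction P V := MulAction.compHom V ρ
  have hdvd : p ∣ Nat.card V := by
    obtain ⟨v, hv⟩ := exists_ne (0 : V)
    have hpv : p • v = 0 := by rw [← Nat.cast_smul_eq_nsmul F, CharP.cast_eq_zero, zero_smul]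
    rw [← addOrderOf_eq_prime hpv hv]
    exact addOrderOf_dvd_natCard v
  obtain ⟨v, hv, hne⟩ := hP.exists_fixed_point_of_prime_dvd_card_of_fixed_point V hdvd
    (a := (0 : V)) (fun g => map_zero (ρ g))
  exact ⟨v, hne.symm, hv⟩

/-- A nonzero invariant linear form, which exists by the fixed point theorem in the dual, would
vanish on `Representation.Coinvariants.ker ρ`. -/
lemma subsingleton_of_coinvariants_ker_eq_top [Finite F] (hP : IsPGroup p P) {V : Type*}
    [AddCommGroup V] [Module F V] [Finite V] {ρ : Representation F P V}
    (hρ : Representation.Coinvariants.ker ρ = ⊤) : Subsingleton V := by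
  by_contra hV
  rw [not_subsingleton_iff_nontrivial] at hV
  have : Finite (Module.Dual F V) := Finite.of_injective _ DFunLike.coe_injective
  obtain ⟨f, hf, hfix⟩ := exists_ne_zero_forall_apply_eq_of_isPGroup hP ρ.dual
  refine hf (LinearMap.ker_eq_top.mp (top_le_iff.mp ?_))
  rw [← hρ, Representation.Coinvariants.ker, Submodule.span_le]
  rintro _ ⟨⟨g, v⟩, rfl⟩
  have hgv := LinearMap.congr_fun (hfix g⁻¹) v
  simpa [Representation.dual_apply, Module.Dual.transpose_apply, sub_eq_zero] using hgv

namespace augSpan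

variable {A : Type*} [Ring A] [Algebra F A] {σ : P →* A}

lemma pow_eq_bot_of_le_pow_succ [Finite F] [Finite A] {T : Subgroup P} (hT : IsPGroup p T)
    {k : ℕ} (hk : k ≠ 0)
    (hle : augSpan F σ T ^ k ≤ augSpan F σ T ^ (k + 1)) : augSpan F σ T ^ k = ⊥ := by
  let leftMul : Representation F T A :=
    ((Algebra.lmul F A : A →ₐ[F] Module.End F A) : A →* Module.End F A).comp (σ.comp T.subtype)
  let ρ := leftMul.subrepresentation (augSpan F σ T ^ k) fun g _ hx => mul_mem_pow_left hk g.2 hx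
  suffices h : Representation.Coinvariants.ker ρ = ⊤ from
    (Submodule.subsingleton_iff_eq_bot).mp (subsingleton_of_coinvariants_ker_eq_top hT h)
  suffices h : augSpan F σ T ^ k ≤ (Representation.Coinvariants.ker ρ).map (Submodule.subtype _) by
    refine eq_top_iff.mpr fun x _ => ?_
    obtain ⟨y, hy, hyx⟩ := h x.2
    rwa [← Subtype.ext hyx]
  refine hle.trans ?_
  rw [pow_succ', Submodule.mul_le]
  intro a ha x hx
  induction ha using Submodule.span_induction with
  | mem a ha =>
    obtain ⟨g, hg, rfl⟩ := ha
    exact ⟨_, Representation.Coinvariants.sub_mem_ker (ρ := ρ) ⟨g, hg⟩ ⟨x, hx⟩,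
      (sub_one_mul (σ g) x).symm⟩
  | zero => rw [zero_mul]; exact zero_mem _
  | add a b _ _ ha hb => rw [add_mul]; exact add_mem ha hb
  | smul c a _ ha => rw [smul_mul_assoc]; exact Submodule.smul_mem _ c ha

lemma sub_one_pow_prime_pow [CharP A p] (g : P) (k : ℕ) :
    (σ g - 1) ^ p ^ k = σ (g ^ p ^ k) - 1 := by
  rw [sub_pow_char_pow_of_commute _ _ (Commute.one_right _), one_pow, map_pow]

lemma mul_sub_mul_mem_pow {T : Subgroup P} {k : ℕ} (hk : k ≠ 0) {g h : P} (hg : g ∈ T)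
    (hh : h ∈ T) (hgh : σ ⁅g, h⁆ - 1 ∈ augSpan F σ T ^ k) :
    (σ g - 1) * (σ h - 1) - (σ h - 1) * (σ g - 1) ∈ augSpan F σ T ^ k := by
  have hcomm : (σ g - 1) * (σ h - 1) - (σ h - 1) * (σ g - 1) = (σ ⁅g, h⁆ - 1) * σ (h * g) := by
    have hmul : ⁅g, h⁆ * (h * g) = g * h := by simp [commutatorElement_def, mul_assoc]
    rw [sub_one_mul (σ ⁅g, h⁆), ← map_mul, hmul, map_mul, map_mul]
    noncomm_ring
  rw [hcomm]
  exact mul_mem_pow hk (mul_mem hh hg) hgh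

/-- The elements `σ (e i) - 1` generate the augmentation ideal `J` and have vanishing `p ^ s`-th
powers. They commute modulo `J ^ 3` because `σ (g ^ p ^ 2) - 1 = (σ g - 1) ^ p ^ 2` lies in
`J ^ p ^ 2`, and `3 ≤ p ^ 2`. -/
theorem closure_range_pow_eq_bot [Finite F] [Finite A] {ι : Type*} [Fintype ι]
    {e : ι → P} {s : ℕ} (hP : IsPGroup p (Subgroup.closure (Set.range e)))
    (hcomm : ∀ i j, ⁅e i, e j⁆ ∈ Subgroup.closure (Set.range fun i => e i ^ p ^ 2))
    (hs : ∀ i, e i ^ p ^ s = 1) :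
    augSpan F σ (Subgroup.closure (Set.range e)) ^ (Fintype.card ι * (p ^ s - 1) + 1) = ⊥ := by
  rcases subsingleton_or_nontrivial A with hA | hA
  · exact Subsingleton.elim _ _
  have : CharP A p := charP_of_injective_algebraMap (algebraMap F A).injective p
  have he (i) : e i ∈ Subgroup.closure (Set.range e) := Subgroup.subset_closure ⟨i, rfl⟩
  have h3 : 3 ≤ p ^ 2 := by nlinarith [(Fact.out : p.Prime).two_le]
  refine pow_eq_bot_of_le_pow_succ hP (Nat.succ_ne_zero _)
    (pow_card_mul_pred_add_one_le_pow_succ (x := fun i => σ (e i) - 1)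
      (fun i => sub_one_mem (he i)) ?_ (fun i j => ?_) fun i => ?_)
  · have hgen := closure_le_sup_sq (F := F) (σ := σ) (Set.range e)
    rwa [range_eq_span] at hgen
  · refine mul_sub_mul_mem_pow three_ne_zero (he i) (he j)
      (sub_one_mem_of_mem_closure (fun g hg x hx => mul_mem_pow three_ne_zero ?_ hx) ?_
        (hcomm i j))
    · exact Subgroup.closure_le _ |>.mpr (by rintro _ ⟨l, rfl⟩; exact pow_mem (he l) _) hg
    · rintro _ ⟨l, rfl⟩
      beta_reduce
      rw [← sub_one_pow_prime_pow (p := p)]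
      exact pow_le_pow _ three_ne_zero h3 (Submodule.pow_mem_pow _ (sub_one_mem (he l)) _)
  · rw [sub_one_pow_prime_pow, hs, map_one, sub_self]

end augSpan

end PGroup

section RestrictRangePow

variable {R M : Type*} [Ring R] [AddCommGroup M] [Module R M]

/-- The endomorphism of `φᵏ(M)` induced by `φ`. -/
def restrictRangePow (φ : Module.End R M) (k : ℕ) : Module.End R (LinearMap.range (φ ^ k)) :=
  φ.restrict <| by
    rintro _ ⟨y, rfl⟩
    exact ⟨φ y, by rw [← Module.End.mul_apply, ← pow_succ, pow_succ', Module.End.mul_apply]⟩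

lemma coe_restrictRangePow_pow (φ : Module.End R M) (k j : ℕ) (x : LinearMap.range (φ ^ k)) :
    ((restrictRangePow φ k ^ j) x : M) = (φ ^ j) x := by
  rw [restrictRangePow, Module.End.pow_restrict]
  rfl

lemma iInf_range_restrictRangePow_pow {φ : Module.End R M}
    (hφ : (⨅ k ≥ 1, LinearMap.range (φ ^ k)) = ⊥) (k : ℕ) :
    (⨅ j ≥ 1, LinearMap.range (restrictRangePow φ k ^ j)) = ⊥ := by
  refine (Submodule.eq_bot_iff _).mpr fun x hx => Subtype.ext ?_
  suffices h : (x : M) ∈ (⨅ j ≥ 1, LinearMap.range (φ ^ j)) by rwa [hφ] at h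
  simp only [Submodule.mem_iInf] at hx ⊢
  intro j hj
  obtain ⟨y, rfl⟩ := hx j hj
  exact ⟨y, (coe_restrictRangePow_pow φ k j y).symm⟩

lemma range_restrictRangePow (φ : Module.End R M) (k : ℕ) :
    LinearMap.range (restrictRangePow φ k) =
      (LinearMap.range (φ ^ (k + 1))).submoduleOf (LinearMap.range (φ ^ k)) := by
  ext x
  rw [Submodule.submoduleOf, Submodule.mem_comap, pow_succ']
  constructor
  · rintro ⟨⟨_, y, rfl⟩, rfl⟩
    exact ⟨y, rfl⟩
  · rintro ⟨y, hy⟩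
    exact ⟨⟨(φ ^ k) y, y, rfl⟩, Subtype.ext hy⟩

end RestrictRangePow

section ReductionModulo

lemma finrank_le_mul_finrank_quotient_range_add {F V : Type*} [Field F] [AddCommGroup V]
    [Module F V] [Module.Finite F V] (f : V →ₗ[F] V) (k : ℕ) :
    Module.finrank F V ≤ k * Module.finrank F (V ⧸ LinearMap.range f) +
      Module.finrank F (LinearMap.range (f ^ k)) := by
  induction k with
  | zero => rw [zero_mul, zero_add, pow_zero, Module.End.one_eq_id, LinearMap.range_id, finrank_top]
  | succ k ih =>
    let g := f.domRestrict (LinearMap.range (f ^ k))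
    have hrange : LinearMap.range g = LinearMap.range (f ^ (k + 1)) := by
      rw [LinearMap.range_domRestrict, pow_succ', Module.End.mul_eq_comp, LinearMap.range_comp]
    have hker : Module.finrank F (LinearMap.ker g) ≤ Module.finrank F (LinearMap.ker f) := by
      rw [← Submodule.finrank_map_subtype_eq]
      exact Submodule.finrank_mono (by rintro _ ⟨x, hx, rfl⟩; exact hx)
    have hg := g.finrank_range_add_finrank_ker
    have hf := f.finrank_range_add_finrank_ker
    have hquot := (LinearMap.range f).finrank_quotient_add_finrank
    rw [hrange] at hg
    rw [add_one_mul]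
    omega

variable {F R M M' : Type*} [Field F] [Ring R] [Algebra F R]
  [AddCommGroup M] [Module F M] [Module R M] [IsScalarTower F R M]
  [AddCommGroup M'] [Module F M'] [Module R M'] [IsScalarTower F R M']
  {I J : Submodule F R}

lemma map_mem_smul_top (f : M →ₗ[R] M') {m : M} (hm : m ∈ I • (⊤ : Submodule F M)) :
    f m ∈ I • (⊤ : Submodule F M') := by
  refine Submodule.smul_induction_on hm (fun r hr m _ => ?_) fun x y hx hy => ?_
  · rw [map_smul]
    exact Submodule.smul_mem_smul hr trivial
  · rw [map_add]
    exact add_mem hx hy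

lemma exists_mem_smul_top_map_eq {f : M →ₗ[R] M'} (hf : Function.Surjective f) {m' : M'}
    (hm' : m' ∈ I • (⊤ : Submodule F M')) : ∃ m ∈ I • (⊤ : Submodule F M), f m = m' := by
  refine Submodule.smul_induction_on hm' (fun r hr m' _ => ?_) ?_
  · obtain ⟨m, rfl⟩ := hf m'
    exact ⟨r • m, Submodule.smul_mem_smul hr trivial, map_smul f r m⟩
  · rintro _ _ ⟨x, hx, rfl⟩ ⟨y, hy, rfl⟩
    exact ⟨x + y, add_mem hx hy, map_add f x y⟩

lemma mul_top_smul_top_le : (I * ⊤) • (⊤ : Submodule F M) ≤ I • ⊤ := by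
  rw [← smul_eq_mul, Submodule.smul_assoc]
  exact Submodule.smul_mono le_rfl le_top

lemma pow_mul_apply_mem_pow_smul {φ : Module.End R M} {k : ℕ}
    (hk : ∀ m, (φ ^ k) m ∈ J • (⊤ : Submodule F M)) (a : ℕ) (m : M) :
    (φ ^ (k * a)) m ∈ J ^ a • (⊤ : Submodule F M) := by
  induction a generalizing m with
  | zero => rw [pow_zero, Submodule.one_smul]; trivial
  | succ a ih =>
    rw [mul_add_one, pow_add φ, Module.End.mul_apply]
    refine Submodule.smul_induction_on (hk m) (fun j hj m' _ => ?_) fun x y hx hy => ?_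
    · rw [map_smul, pow_succ', ← smul_eq_mul, Submodule.smul_assoc]
      exact Submodule.smul_mem_smul hj (ih m')
    · rw [map_add]; exact Submodule.add_mem _ hx hy

/-- The quotient `M / IM` of an `R`-module by the span of the products of the elements of a linear
subspace `I` of `R` with the elements of `M`. -/
abbrev ReductionMod {F R : Type*} [Field F] [Ring R] [Algebra F R] (I : Submodule F R) (M : Type*)
    [AddCommGroup M] [Module F M] [Module R M] [IsScalarTower F R M] : Type _ :=
  M ⧸ (I • (⊤ : Submodule F M))

namespace ReductionMod

variable (I) in
/-- The `F`-linear endomorphism of `M / IM` induced by `φ`. -/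
def mapEnd (φ : Module.End R M) : Module.End F (ReductionMod I M) :=
  Submodule.mapQ _ _ (φ.restrictScalars F) fun _ hm => map_mem_smul_top φ hm

lemma mapEnd_pow_mk (φ : Module.End R M) (k : ℕ) (m : M) :
    (mapEnd I φ ^ k) (Submodule.Quotient.mk m) = Submodule.Quotient.mk ((φ ^ k) m) := by
  induction k with
  | zero => rfl
  | succ k ih => rw [pow_succ', pow_succ', Module.End.mul_apply, ih]; rfl

lemma finrank_le_of_surjective [Module.Finite F (ReductionMod I M)] {V : Type*} [AddCommGroup V]
    [Module F V] {g : M →ₗ[F] V} (hg : Function.Surjective g)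
    (hI : ∀ m ∈ I • (⊤ : Submodule F M), g m = 0) :
    Module.finrank F V ≤ Module.finrank F (ReductionMod I M) := by
  have hle : I • (⊤ : Submodule F M) ≤ LinearMap.ker g := hI
  refine LinearMap.finrank_le_finrank_of_surjective (f := (I • (⊤ : Submodule F M)).liftQ g hle) ?_
  rw [← LinearMap.range_eq_top, Submodule.range_liftQ, LinearMap.range_eq_top.mpr hg]

/-- A product of copies of `R / IR` surjects onto `M / IM`. -/
lemma finite_of_finite_quotient_mul_top [Module.Finite R M] [Module.Finite F (R ⧸ (I * ⊤))] :
    Module.Finite F (ReductionMod I M) := by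
  obtain ⟨n, v, hv⟩ := Module.Finite.exists_fin (R := R) (M := M)
  let term (i : Fin n) : (R ⧸ (I * ⊤)) →ₗ[F] ReductionMod I M :=
    Submodule.mapQ _ _ ((LinearMap.toSpanSingleton R M (v i)).restrictScalars F) fun x hx =>
      mul_top_smul_top_le (Submodule.smul_mem_smul hx trivial)
  refine Module.Finite.of_surjective (LinearMap.lsum F (fun _ => R ⧸ (I * ⊤)) F term) fun y => ?_
  obtain ⟨m, rfl⟩ := Submodule.Quotient.mk_surjective _ y
  obtain ⟨c, rfl⟩ :=
    (Submodule.mem_span_range_iff_exists_fun R).mp (hv ▸ Submodule.mem_top (x := m))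
  refine ⟨fun i => Submodule.Quotient.mk (c i), ?_⟩
  rw [LinearMap.lsum_apply, LinearMap.sum_apply, ← Submodule.mkQ_apply, map_sum]
  rfl

lemma finrank_le_of_surjective_linearMap [Module.Finite F (ReductionMod I M)] {f : M →ₗ[R] M'}
    (hf : Function.Surjective f) :
    Module.finrank F (ReductionMod I M') ≤ Module.finrank F (ReductionMod I M) :=
  finrank_le_of_surjective (g := (Submodule.mkQ _).comp (f.restrictScalars F))
    ((Submodule.mkQ_surjective _).comp hf) fun _ hm =>
      (Submodule.Quotient.mk_eq_zero _).mpr (map_mem_smul_top f hm)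

lemma finrank_quotient_range_mapEnd_le [Module.Finite F (ReductionMod I M)] (φ : Module.End R M)
    [Module.Finite F (ReductionMod I (M ⧸ LinearMap.range φ))] :
    Module.finrank F (ReductionMod I M ⧸ LinearMap.range (mapEnd I φ)) ≤
      Module.finrank F (ReductionMod I (M ⧸ LinearMap.range φ)) := by
  let g : (M ⧸ LinearMap.range φ) →ₗ[F] (ReductionMod I M ⧸ LinearMap.range (mapEnd I φ)) :=
    ((LinearMap.range φ).restrictScalars F).liftQ ((Submodule.mkQ _).comp (Submodule.mkQ _)) <| by
      rintro _ ⟨m, rfl⟩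
      exact (Submodule.Quotient.mk_eq_zero _).mpr ⟨Submodule.Quotient.mk m, rfl⟩
  have hg (m : M) : g (Submodule.Quotient.mk m) =
    Submodule.Quotient.mk (Submodule.Quotient.mk m) := rfl
  refine finrank_le_of_surjective (g := g) ?_ fun x hx => ?_
  · intro y
    obtain ⟨y, rfl⟩ := Submodule.Quotient.mk_surjective _ y
    obtain ⟨m, rfl⟩ := Submodule.Quotient.mk_surjective _ y
    exact ⟨Submodule.Quotient.mk m, rfl⟩
  · obtain ⟨m, hm, rfl⟩ := exists_mem_smul_top_map_eq (LinearMap.range φ).mkQ_surjective hx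
    rw [Submodule.mkQ_apply, hg, (Submodule.Quotient.mk_eq_zero _).mpr hm]
    rfl

lemma finrank_range_mapEnd_pow_le (φ : Module.End R M) (k : ℕ)
    [Module.Finite F (ReductionMod I (LinearMap.range (φ ^ k)))] :
    Module.finrank F (LinearMap.range (mapEnd I φ ^ k)) ≤
      Module.finrank F (ReductionMod I (LinearMap.range (φ ^ k))) := by
  let g : LinearMap.range (φ ^ k) →ₗ[F] LinearMap.range (mapEnd I φ ^ k) :=
    LinearMap.codRestrict _ ((Submodule.mkQ _).comp
      ((LinearMap.range (φ ^ k)).subtype.restrictScalars F)) <| by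
        rintro ⟨_, m, rfl⟩
        exact ⟨Submodule.Quotient.mk m, mapEnd_pow_mk φ k m⟩
  refine finrank_le_of_surjective (g := g) ?_ fun x hx => ?_
  · rintro ⟨_, y, rfl⟩
    obtain ⟨m, rfl⟩ := Submodule.Quotient.mk_surjective _ y
    exact ⟨⟨(φ ^ k) m, m, rfl⟩, Subtype.ext (mapEnd_pow_mk φ k m).symm⟩
  · exact Subtype.ext ((Submodule.Quotient.mk_eq_zero _).mpr
      (map_mem_smul_top (LinearMap.range (φ ^ k)).subtype hx))

variable [Module.Finite R M] [Module.Finite F (R ⧸ (I * ⊤))]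

lemma finrank_le_mul_add_finrank_range (φ : Module.End R M) (k : ℕ) :
    Module.finrank F (ReductionMod I M) ≤
      k * Module.finrank F (ReductionMod I (M ⧸ LinearMap.range φ)) +
        Module.finrank F (LinearMap.range (mapEnd I φ ^ k)) := by
  have := finite_of_finite_quotient_mul_top (M := M) (I := I)
  have := finite_of_finite_quotient_mul_top (M := M ⧸ LinearMap.range φ) (I := I)
  exact (finrank_le_mul_finrank_quotient_range_add (mapEnd I φ) k).trans
    (Nat.add_le_add_right (Nat.mul_le_mul_left k (finrank_quotient_range_mapEnd_le φ)) _)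

lemma finrank_le_mul_add (φ : Module.End R M) (k : ℕ) :
    Module.finrank F (ReductionMod I M) ≤
      k * Module.finrank F (ReductionMod I (M ⧸ LinearMap.range φ)) +
        Module.finrank F (ReductionMod I (LinearMap.range (φ ^ k))) := by
  have := finite_of_finite_quotient_mul_top (M := LinearMap.range (φ ^ k)) (I := I)
  exact (finrank_le_mul_add_finrank_range φ k).trans
    (Nat.add_le_add_left (finrank_range_mapEnd_pow_le φ k) _)

lemma finrank_le_mul_of_pow_apply_mem {φ : Module.End R M} {k : ℕ}
    (hk : ∀ m, (φ ^ k) m ∈ I • (⊤ : Submodule F M)) :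
    Module.finrank F (ReductionMod I M) ≤
      k * Module.finrank F (ReductionMod I (M ⧸ LinearMap.range φ)) := by
  have hzero : mapEnd I φ ^ k = 0 := LinearMap.ext fun y => by
    obtain ⟨m, rfl⟩ := Submodule.Quotient.mk_surjective _ y
    rw [mapEnd_pow_mk, (Submodule.Quotient.mk_eq_zero _).mpr (hk m), LinearMap.zero_apply]
  have hle := finrank_le_mul_add_finrank_range (I := I) φ k
  rwa [hzero, LinearMap.range_zero, finrank_bot, add_zero] at hle

end ReductionMod

end ReductionModulo

section Coinvariants

variable {F R P : Type*} [Field F] [Ring R] [Algebra F R] [Group P]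

variable (F) in
/-- The coinvariants under `T` of an `R`-module on which a group `P` acts through a homomorphism
`P →* R`. -/
abbrev CoinvariantsVia (σ : P →* R) (T : Subgroup P) (M : Type*) [AddCommGroup M] [Module F M]
    [Module R M] [IsScalarTower F R M] : Type _ :=
  Representation.Coinvariants
    ((((Algebra.lsmul F F M : R →ₐ[F] Module.End F M) : R →* Module.End F M).comp σ).comp T.subtype)

namespace CoinvariantsVia

variable (σ : P →* R) (T : Subgroup P) (M : Type*) [AddCommGroup M] [Module F M] [Module R M]
  [IsScalarTower F R M]

lemma ker_eq_augSpan_smul_top :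
    Representation.Coinvariants.ker ((((Algebra.lsmul F F M : R →ₐ[F] Module.End F M) :
      R →* Module.End F M).comp σ).comp T.subtype) = augSpan F σ T • (⊤ : Submodule F M) := by
  apply le_antisymm
  · rw [Representation.Coinvariants.ker, Submodule.span_le]
    rintro _ ⟨⟨g, m⟩, rfl⟩
    have hmem := Submodule.smul_mem_smul (augSpan.sub_one_mem (F := F) (σ := σ) g.2)
      (Submodule.mem_top (R := F) (x := m))
    rwa [sub_smul, one_smul] at hmem
  · rw [Submodule.smul_le]
    intro a ha m _
    induction ha using Submodule.span_induction with
    | mem a ha =>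
      obtain ⟨g, hg, rfl⟩ := ha
      rw [sub_smul, one_smul]
      exact Submodule.subset_span ⟨(⟨g, hg⟩, m), rfl⟩
    | zero => rw [zero_smul]; exact zero_mem _
    | add a b _ _ ha hb => rw [add_smul]; exact add_mem ha hb
    | smul c a _ ha => rw [smul_assoc]; exact Submodule.smul_mem _ c ha

/-- The coinvariants under `T` are the reduction modulo the span of the `σ t - 1`, `t ∈ T`. -/
def equivReductionMod : CoinvariantsVia F σ T M ≃ₗ[F] ReductionMod (augSpan F σ T) M :=
  Submodule.quotEquivOfEq _ _ (ker_eq_augSpan_smul_top σ T M)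

lemma finrank_eq : Module.finrank F (CoinvariantsVia F σ T M) =
    Module.finrank F (ReductionMod (augSpan F σ T) M) :=
  (equivReductionMod σ T M).finrank_eq

section Growth

variable {σ} {ν : Type*} {T : ν → Subgroup P} {M}
  [Module.Finite R M] {φ : Module.End R M}

theorem finite_of_finite_quotient_mul_top {T : Subgroup P}
    [Module.Finite F (R ⧸ (augSpan F σ T * ⊤))] : Module.Finite F (CoinvariantsVia F σ T M) :=
  have := ReductionMod.finite_of_finite_quotient_mul_top (M := M) (I := augSpan F σ T)
  Module.Finite.equiv (equivReductionMod σ T M).symm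

variable [∀ n, Module.Finite F (R ⧸ (augSpan F σ (T n) * ⊤))]

theorem comparable_finrank_quotient_range (hφ : IsNilpotent φ) :
    Comparable (fun n => Module.finrank F (CoinvariantsVia F σ (T n) M))
      (fun n => Module.finrank F (CoinvariantsVia F σ (T n) (M ⧸ LinearMap.range φ))) := by
  simp only [finrank_eq]
  obtain ⟨k, hk⟩ := hφ
  refine ⟨⟨k, fun n => ReductionMod.finrank_le_mul_of_pow_apply_mem fun m => ?_⟩,
    ⟨1, fun n => ?_⟩⟩
  · rw [hk]; exact zero_mem _
  · have := ReductionMod.finite_of_finite_quotient_mul_top (M := M) (I := augSpan F σ (T n))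
    rw [one_mul]
    exact ReductionMod.finrank_le_of_surjective_linearMap (LinearMap.range φ).mkQ_surjective

end Growth

end CoinvariantsVia

end Coinvariants

section CompactRing

lemma exists_range_iterate_subset {X : Type*} [TopologicalSpace X] [CompactSpace X] [T2Space X]
    {f : X → X} (hf : Continuous f) {W : Set X} (hW : IsOpen W)
    (hsub : ⋂ k : ℕ, Set.range f^[k] ⊆ W) : ∃ k : ℕ, Set.range f^[k] ⊆ W := by
  refine exists_subset_nhds_of_compactSpace (directed_of_isDirected_le fun i j hij => ?_)
    (fun k => (isCompact_range (hf.iterate k)).isClosed) fun x hx => hW.mem_nhds (hsub hx)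
  obtain ⟨l, rfl⟩ := Nat.exists_eq_add_of_le hij
  rw [Function.iterate_add]
  exact Set.range_comp_subset_range _ _

variable {F R M : Type*} [Field F] [Ring R] [Algebra F R] [TopologicalSpace R] [IsTopologicalRing R]
  [AddCommGroup M] [Module F M] [Module R M] [IsScalarTower F R M] {J : Submodule F R}

lemma isOpen_preimage_smul_top {ι : Type*} [Finite ι] (hJ : IsOpen (J : Set R))
    (f : (ι → R) →ₗ[R] M) : IsOpen {x | f x ∈ J • (⊤ : Submodule F M)} := by
  classical
  have := Fintype.ofFinite ι
  let W : AddSubgroup (ι → R) := (J • (⊤ : Submodule F M)).toAddSubgroup.comap f.toAddMonoidHom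
  have hle : (Set.univ.pi fun _ => (J : Set R)) ⊆ (W : Set (ι → R)) := by
    intro x hx
    change f x ∈ J • (⊤ : Submodule F M)
    rw [pi_eq_sum_univ x, map_sum]
    refine Submodule.sum_mem _ fun i _ => ?_
    rw [map_smul]
    exact Submodule.smul_mem_smul (hx i trivial) trivial
  exact W.isOpen_of_mem_nhds <| Filter.mem_of_superset
    ((isOpen_set_pi Set.finite_univ fun _ _ => hJ).mem_nhds fun _ _ => J.zero_mem) hle

/-- Lift `φ` to an endomorphism `ψ` of a finite free module `L`. By compactness of `L`, the
preimage of `J • ⊤` in `L`, which is open, contains `ψᵏ(L)` as soon as it contains `⋂ ψᵏ(L)`. -/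
theorem exists_pow_apply_mem_smul_top [CompactSpace R] [T2Space R] [Module.Finite R M]
    (hJ : IsOpen (J : Set R)) {φ : Module.End R M}
    (hφ : (⨅ k ≥ 1, LinearMap.range (φ ^ k)) = ⊥) :
    ∃ k : ℕ, ∀ m, (φ ^ k) m ∈ J • (⊤ : Submodule F M) := by
  obtain ⟨d, s, hs⟩ := Module.Finite.exists_fin' R M
  obtain ⟨ψ, hψ⟩ := Module.projective_lifting_property s (φ ∘ₗ s) hs
  have hpow (k : ℕ) (x : Fin d → R) : s (ψ^[k] x) = (φ ^ k) (s x) := by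
    rw [Module.End.pow_apply]
    exact (Function.Semiconj.iterate_right (f := s) (LinearMap.congr_fun hψ) k) x
  have hsub : ⋂ k : ℕ, Set.range ψ^[k] ⊆ {x | s x ∈ J • (⊤ : Submodule F M)} := by
    intro x hx
    have hx' : s x ∈ (⨅ k ≥ 1, LinearMap.range (φ ^ k)) := by
      simp only [Submodule.mem_iInf]
      intro k _
      obtain ⟨y, rfl⟩ := Set.mem_iInter.mp hx k
      exact ⟨s y, (hpow k y).symm⟩
    rw [hφ, Submodule.mem_bot] at hx'
    rw [Set.mem_ofPred_eq, hx']
    exact zero_mem _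
  obtain ⟨k, hk⟩ := exists_range_iterate_subset (LinearMap.continuous_on_pi ψ)
    (isOpen_preimage_smul_top hJ s) hsub
  refine ⟨k, fun m => ?_⟩
  obtain ⟨y, rfl⟩ := hs m
  rw [← hpow]
  exact hk ⟨y, rfl⟩

namespace CoinvariantsVia

variable {P ν : Type*} [Group P] [CompactSpace R] [T2Space R] [Module.Finite R M] {σ : P →* R}
  {T : ν → Subgroup P} [∀ n, Module.Finite F (R ⧸ (augSpan F σ (T n) * ⊤))] {q : ν → ℕ} {c : ℕ}
  {φ : Module.End R M}

theorem dominated_finrank_quotient_range (hJ : IsOpen (J : Set R))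
    (hJT : ∀ n, J ^ (c * q n) ≤ augSpan F σ (T n) * ⊤)
    (hφ : (⨅ k ≥ 1, LinearMap.range (φ ^ k)) = ⊥) :
    Dominated (fun n => Module.finrank F (CoinvariantsVia F σ (T n) M))
      (fun n => q n * Module.finrank F (CoinvariantsVia F σ (T n) (M ⧸ LinearMap.range φ))) := by
  obtain ⟨k, hk⟩ := exists_pow_apply_mem_smul_top hJ hφ
  simp only [finrank_eq]
  refine ⟨k * c, fun n => ?_⟩
  have hmem (m : M) : (φ ^ (k * (c * q n))) m ∈ augSpan F σ (T n) • (⊤ : Submodule F M) :=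
    mul_top_smul_top_le (Submodule.smul_mono_left (hJT n) (pow_mul_apply_mem_pow_smul hk _ m))
  simpa only [mul_assoc] using ReductionMod.finrank_le_mul_of_pow_apply_mem hmem

theorem dominated_max_finrank_gradedPiece (hJ : IsOpen (J : Set R))
    (hJT : ∀ n, J ^ (c * q n) ≤ augSpan F σ (T n) * ⊤)
    (hφ : (⨅ k ≥ 1, LinearMap.range (φ ^ k)) = ⊥) (k : ℕ) :
    Dominated (fun n => Module.finrank F (CoinvariantsVia F σ (T n) M))
      (fun n => max (Module.finrank F (CoinvariantsVia F σ (T n) (M ⧸ LinearMap.range φ)))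
        (q n * Module.finrank F (CoinvariantsVia F σ (T n) (gradedPiece φ k)))) := by
  obtain ⟨C, hC⟩ := dominated_finrank_quotient_range hJ hJT (iInf_range_restrictRangePow_pow hφ k)
  rw [range_restrictRangePow] at hC
  simp only [finrank_eq] at hC ⊢
  refine ⟨k + C, fun n => ?_⟩
  rw [add_mul]
  exact (ReductionMod.finrank_le_mul_add φ k).trans (add_le_add
    (Nat.mul_le_mul_left _ (le_max_left _ _))
    ((hC n).trans (Nat.mul_le_mul_left _ (le_max_right _ _))))

end CoinvariantsVia

end CompactRing

namespace augSpan

variable {F P A : Type*} [CommRing F] [Group P] [Ring A] [Algebra F A] {σ : P →* A}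

lemma top_mul_le_mul_top (hσ : Submodule.span F (Set.range σ) = ⊤) (K : Subgroup P) [K.Normal] :
    ⊤ * augSpan F σ K ≤ augSpan F σ K * ⊤ := by
  rw [← hσ, augSpan, Submodule.span_mul_span, Submodule.span_le, hσ]
  rintro _ ⟨_, ⟨g, rfl⟩, _, ⟨k, hk, rfl⟩, rfl⟩
  have hconj : σ g * (σ k - 1) = (σ (g * k * g⁻¹) - 1) * σ g := by
    rw [sub_one_mul (σ (g * k * g⁻¹)), ← map_mul, inv_mul_cancel_right, mul_sub_one, map_mul]
  beta_reduce
  rw [hconj]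
  exact Submodule.mul_mem_mul (sub_one_mem (Subgroup.Normal.conj_mem ‹_› k hk g)) trivial

end augSpan

lemma mul_top_pow_le {F A : Type*} [CommSemiring F] [Semiring A] [Algebra F A]
    {I : Submodule F A} (hI : ⊤ * I ≤ I * ⊤) (m : ℕ) : (I * ⊤) ^ m ≤ I ^ m * ⊤ := by
  induction m with
  | zero => rw [pow_zero, pow_zero, one_mul]; exact le_top
  | succ m ih =>
    calc (I * ⊤) ^ (m + 1) = (I * ⊤) ^ m * (I * ⊤) := pow_succ _ _
      _ ≤ I ^ m * ⊤ * (I * ⊤) := mul_le_mul_left ih _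
      _ = I ^ m * (⊤ * I) * ⊤ := by simp only [mul_assoc]
      _ ≤ I ^ m * (I * ⊤) * ⊤ := mul_le_mul_left (mul_le_mul_right hI _) _
      _ = I ^ (m + 1) * (⊤ * ⊤) := by rw [pow_succ]; simp only [mul_assoc]
      _ ≤ I ^ (m + 1) * ⊤ := mul_le_mul_right le_top _

lemma mem_span_range_mul_top_iff {F A ι : Type*} [CommSemiring F] [Semiring A] [Algebra F A]
    [Fintype ι] {a : ι → A} {x : A} :
    x ∈ Submodule.span F (Set.range a) * ⊤ ↔ ∃ y : ι → A, ∑ i, a i * y i = x := by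
  constructor
  · intro hx
    refine Submodule.mul_induction_on hx (fun b hb y _ => ?_) ?_
    · obtain ⟨c, rfl⟩ := (Submodule.mem_span_range_iff_exists_fun F).mp hb
      exact ⟨fun i => c i • y, by simp only [Finset.sum_mul, smul_mul_assoc, mul_smul_comm]⟩
    · rintro _ _ ⟨y, rfl⟩ ⟨z, rfl⟩
      exact ⟨y + z, by simp only [Pi.add_apply, mul_add, Finset.sum_add_distrib]⟩
  · rintro ⟨y, rfl⟩
    exact Submodule.sum_mem _ fun i _ =>
      Submodule.mul_mem_mul (Submodule.subset_span ⟨i, rfl⟩) trivial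

lemma span_range_monoidAlgebra_of (F P : Type*) [CommSemiring F] [Monoid P] :
    Submodule.span F (Set.range (MonoidAlgebra.of F P)) = ⊤ := by
  refine eq_top_iff.mpr fun x _ => ?_
  induction x using MonoidAlgebra.induction_linear with
  | zero => exact zero_mem _
  | add x y hx hy => exact add_mem (hx trivial) (hy trivial)
  | single g a =>
    rw [← mul_one a, ← smul_eq_mul, ← MonoidAlgebra.smul_single]
    exact Submodule.smul_mem _ a (Submodule.subset_span ⟨g, rfl⟩)

/-- With `s` a section of `f` on its range, `x - s (f x)` lies in the right-hand side for
every `x`. -/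
lemma ker_mapDomainAlgHom_le {F P Q : Type*} [CommRing F] [Group P] [Group Q] (f : P →* Q) :
    LinearMap.ker (MonoidAlgebra.mapDomainAlgHom F F f).toLinearMap ≤
      augSpan F (MonoidAlgebra.of F P) f.ker * ⊤ := by
  set I := augSpan F (MonoidAlgebra.of F P) f.ker * ⊤
  let s : Q → P := Function.invFun f
  have hs (g : P) : f (s (f g)) = f g := Function.invFun_eq ⟨g, rfl⟩
  have hsub (x : MonoidAlgebra F P) :
      x - MonoidAlgebra.mapDomain s (MonoidAlgebra.mapDomain f x) ∈ I := by
    induction x using MonoidAlgebra.induction_linear with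
    | zero => simp only [MonoidAlgebra.mapDomain_zero, sub_zero, zero_mem]
    | add x y hx hy =>
      rw [MonoidAlgebra.mapDomain_add, MonoidAlgebra.mapDomain_add, add_sub_add_comm]
      exact add_mem hx hy
    | single g a =>
      have hg : g * (s (f g))⁻¹ ∈ f.ker := by
        rw [MonoidHom.mem_ker, map_mul, map_inv, hs, mul_inv_cancel]
      have hmem : (MonoidAlgebra.of F P (g * (s (f g))⁻¹) - 1) *
          MonoidAlgebra.single (s (f g)) a ∈ I :=
        Submodule.mul_mem_mul (augSpan.sub_one_mem hg) trivial
      rw [sub_one_mul, MonoidAlgebra.of_apply, MonoidAlgebra.single_mul_single,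
        inv_mul_cancel_right, one_mul] at hmem
      rwa [MonoidAlgebra.mapDomain_single, MonoidAlgebra.mapDomain_single]
  intro x hx
  have hfx : MonoidAlgebra.mapDomain f x = 0 := hx
  have hxI := hsub x
  rwa [hfx, MonoidAlgebra.mapDomain_zero, sub_zero] at hxI

namespace completedGroupAlgebra

section Projections

variable {F : Type*} [Field F] {G : Type*} [Group G] [TopologicalSpace G]

variable (F) in
/-- The projection `F[[G]] → F[G/N]`. -/
noncomputable def proj (N : OpenNormalSubgroup G) :
    completedGroupAlgebra F G →ₐ[F] MonoidAlgebra F (G ⧸ N.toSubgroup) :=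
  (Pi.evalAlgHom F (fun N : OpenNormalSubgroup G => MonoidAlgebra F (G ⧸ N.toSubgroup)) N).comp
    (completedGroupAlgebra F G).val

lemma map_proj {N N' : OpenNormalSubgroup G} (h : N.toSubgroup ≤ N'.toSubgroup)
    (x : completedGroupAlgebra F G) :
    MonoidAlgebra.mapDomainAlgHom F F
      (QuotientGroup.map N.toSubgroup N'.toSubgroup (MonoidHom.id G) h) (proj F N x) =
      proj F N' x := x.2 N N' h

lemma proj_eq_of_le {N N' : OpenNormalSubgroup G} (h : N.toSubgroup ≤ N'.toSubgroup)
    {x y : completedGroupAlgebra F G} (hxy : proj F N x = proj F N y) :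
    proj F N' x = proj F N' y := by
  rw [← map_proj h, hxy, map_proj h]

lemma ext_proj {x y : completedGroupAlgebra F G} (h : ∀ N, proj F N x = proj F N y) : x = y :=
  Subtype.ext (funext h)

lemma proj_comp_of (N : OpenNormalSubgroup G) :
    (proj F N : _ →* MonoidAlgebra F (G ⧸ N.toSubgroup)).comp (of F G) =
      (MonoidAlgebra.of F (G ⧸ N.toSubgroup)).comp (QuotientGroup.mk' N.toSubgroup) := rfl

lemma proj_surjective (N : OpenNormalSubgroup G) : Function.Surjective (proj F N) := by
  suffices h : LinearMap.range (proj F N).toLinearMap = ⊤ from LinearMap.range_eq_top.mp h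
  rw [eq_top_iff, ← span_range_monoidAlgebra_of, Submodule.span_le]
  rintro _ ⟨g, rfl⟩
  obtain ⟨g, rfl⟩ := QuotientGroup.mk_surjective g
  exact ⟨of F G g, rfl⟩

lemma map_proj_augSpan_mul_top (N : OpenNormalSubgroup G) (S : Set G) :
    (augSpan F (of F G) S * ⊤).map (proj F N).toLinearMap =
      augSpan F (MonoidAlgebra.of F (G ⧸ N.toSubgroup)) (QuotientGroup.mk' N.toSubgroup '' S) *
        ⊤ := by
  rw [Submodule.map_mul, augSpan.map, proj_comp_of, augSpan.comp, Submodule.map_top,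
    LinearMap.range_eq_top.mpr (proj_surjective N)]

lemma map_ker_proj_le {N L : OpenNormalSubgroup G} (h : N.toSubgroup ≤ L.toSubgroup) :
    (LinearMap.ker (proj F L).toLinearMap).map (proj F N).toLinearMap ≤
      augSpan F (MonoidAlgebra.of F (G ⧸ N.toSubgroup))
        (L.toSubgroup.map (QuotientGroup.mk' N.toSubgroup)) * ⊤ := by
  rintro _ ⟨x, hx, rfl⟩
  rw [← Subgroup.comap_id L.toSubgroup, ← QuotientGroup.ker_map _ _ _ h]
  exact ker_mapDomainAlgHom_le _ ((map_proj h x).trans hx)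

lemma map_ker_proj_pow_le {N L : OpenNormalSubgroup G} (h : N.toSubgroup ≤ L.toSubgroup) (m : ℕ) :
    (LinearMap.ker (proj F L).toLinearMap ^ m).map (proj F N).toLinearMap ≤
      augSpan F (MonoidAlgebra.of F (G ⧸ N.toSubgroup))
        (L.toSubgroup.map (QuotientGroup.mk' N.toSubgroup)) ^ m * ⊤ := by
  have : (L.toSubgroup.map (QuotientGroup.mk' N.toSubgroup)).Normal :=
    Subgroup.Normal.map L.isNormal' _ (QuotientGroup.mk'_surjective _)
  rw [Submodule.map_pow]
  exact (pow_le_pow_left' (map_ker_proj_le h) m).trans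
    (mul_top_pow_le (augSpan.top_mul_le_mul_top (span_range_monoidAlgebra_of _ _) _) m)

end Projections

section Compact

variable {F : Type*} [Field F] {G : Type*} [Group G] [TopologicalSpace G]

local instance instTopologicalSpaceMonoidAlgebra (P : Type*) :
    TopologicalSpace (MonoidAlgebra F P) := ⊥

local instance instDiscreteTopologyMonoidAlgebra (P : Type*) :
    DiscreteTopology (MonoidAlgebra F P) := ⟨rfl⟩

local instance instIsTopologicalRing : IsTopologicalRing (completedGroupAlgebra F G) :=
  inferInstanceAs (IsTopologicalRing (completedGroupAlgebra F G).toSubring)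

lemma continuous_proj (N : OpenNormalSubgroup G) : Continuous (proj F N) :=
  (continuous_apply N).comp continuous_subtype_val

lemma isOpen_ker_proj (N : OpenNormalSubgroup G) :
    IsOpen (LinearMap.ker (proj F N).toLinearMap : Set (completedGroupAlgebra F G)) :=
  (isOpen_discrete {0}).preimage (continuous_proj N)

lemma isClosed_coe : IsClosed (completedGroupAlgebra F G :
    Set (∀ N : OpenNormalSubgroup G, MonoidAlgebra F (G ⧸ N.toSubgroup))) := by
  suffices h : (completedGroupAlgebra F G :
      Set (∀ N : OpenNormalSubgroup G, MonoidAlgebra F (G ⧸ N.toSubgroup))) =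
      ⋂ (N : OpenNormalSubgroup G) (N' : OpenNormalSubgroup G) (h : N.toSubgroup ≤ N'.toSubgroup),
      {x | MonoidAlgebra.mapDomainAlgHom F F
        (QuotientGroup.map N.toSubgroup N'.toSubgroup (MonoidHom.id G) h) (x N) = x N'} by
    rw [h]
    exact isClosed_iInter fun N => isClosed_iInter fun N' => isClosed_iInter fun _ =>
      isClosed_eq (continuous_of_discreteTopology.comp (continuous_apply N)) (continuous_apply N')
  ext x
  simp only [Set.mem_iInter]
  rfl

variable [Finite F] [IsTopologicalGroup G] [CompactSpace G]

lemma finite_monoidAlgebra_quotient (N : OpenNormalSubgroup G) :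
    Finite (MonoidAlgebra F (G ⧸ N.toSubgroup)) :=
  have : Finite ((G ⧸ N.toSubgroup) →₀ F) := Finite.of_injective _ DFunLike.coe_injective
  Finite.of_equiv _ MonoidAlgebra.coeffEquiv.symm

lemma compactSpace : CompactSpace (completedGroupAlgebra F G) :=
  have := finite_monoidAlgebra_quotient (F := F) (G := G)
  isCompact_iff_compactSpace.mp isClosed_coe.isCompact

section Growth

variable {P ν : Type*} [Group P] {σ : P →* completedGroupAlgebra F G} {T : ν → Subgroup P}
  [∀ n, Module.Finite F (completedGroupAlgebra F G ⧸ (augSpan F σ (T n) * ⊤))]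
  {N : OpenNormalSubgroup G} {q : ν → ℕ} {c : ℕ}
  (hJ : ∀ n, LinearMap.ker (proj F N).toLinearMap ^ (c * q n) ≤ augSpan F σ (T n) * ⊤)
  {M : Type*} [AddCommGroup M] [Module F M] [Module (completedGroupAlgebra F G) M]
  [IsScalarTower F (completedGroupAlgebra F G) M] [Module.Finite (completedGroupAlgebra F G) M]
  {φ : Module.End (completedGroupAlgebra F G) M} (hφ : (⨅ k ≥ 1, LinearMap.range (φ ^ k)) = ⊥)

include hJ hφ

theorem dominated_finrank_coinvariants_quotient_range :
    Dominated (fun n => Module.finrank F (CoinvariantsVia F σ (T n) M))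
      (fun n => q n * Module.finrank F (CoinvariantsVia F σ (T n) (M ⧸ LinearMap.range φ))) :=
  have := compactSpace (F := F) (G := G)
  CoinvariantsVia.dominated_finrank_quotient_range (isOpen_ker_proj N) hJ hφ

theorem dominated_max_finrank_coinvariants_gradedPiece (k : ℕ) :
    Dominated (fun n => Module.finrank F (CoinvariantsVia F σ (T n) M))
      (fun n => max (Module.finrank F (CoinvariantsVia F σ (T n) (M ⧸ LinearMap.range φ)))
        (q n * Module.finrank F (CoinvariantsVia F σ (T n) (gradedPiece φ k)))) :=
  have := compactSpace (F := F) (G := G)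
  CoinvariantsVia.dominated_max_finrank_gradedPiece (isOpen_ker_proj N) hJ hφ k

end Growth

/-- A finitely generated right ideal of the compact ring `F[[G]]` is closed. -/
theorem mem_span_range_mul_top_of_forall_proj_mem {ι : Type*} [Finite ι]
    {a : ι → completedGroupAlgebra F G} {x : completedGroupAlgebra F G}
    (hx : ∀ N, proj F N x ∈ (Submodule.span F (Set.range a) * ⊤).map (proj F N).toLinearMap) :
    x ∈ Submodule.span F (Set.range a) * ⊤ := by
  have := Fintype.ofFinite ι
  have := compactSpace (F := F) (G := G)
  let S (N : OpenNormalSubgroup G) : Set (ι → completedGroupAlgebra F G) :=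
    {y | proj F N (∑ i, a i * y i) = proj F N x}
  have hclosed (N) : IsClosed (S N) :=
    isClosed_eq ((continuous_proj N).comp (by fun_prop)) continuous_const
  have hne (N) : (S N).Nonempty := by
    obtain ⟨z, hz, hzx⟩ := hx N
    obtain ⟨y, rfl⟩ := mem_span_range_mul_top_iff.mp hz
    exact ⟨y, hzx⟩
  have : Nonempty (OpenNormalSubgroup G) := ⟨⟨⊤, inferInstanceAs (⊤ : Subgroup G).Normal⟩⟩
  obtain ⟨y, hy⟩ := IsCompact.nonempty_iInter_of_directed_nonempty_isCompact_isClosed S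
    (fun N N' => ⟨N ⊓ N', fun _ => proj_eq_of_le (N := N ⊓ N') inf_le_left,
      fun _ => proj_eq_of_le (N := N ⊓ N') inf_le_right⟩)
    hne (fun N => (hclosed N).isCompact) hclosed
  exact mem_span_range_mul_top_iff.mpr ⟨y, ext_proj fun N => Set.mem_iInter.mp hy N⟩

variable {L : OpenNormalSubgroup G}

theorem ker_proj_le_of_le_closure_sup {ι : Type*} [Finite ι] {e : ι → G}
    (he : ∀ N : OpenNormalSubgroup G,
      L.toSubgroup ≤ Subgroup.closure (Set.range e) ⊔ N.toSubgroup) :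
    LinearMap.ker (proj F L).toLinearMap ≤ augSpan F (of F G) (Set.range e) * ⊤ := by
  intro x hx
  rw [augSpan.range_eq_span]
  refine mem_span_range_mul_top_of_forall_proj_mem fun N => ?_
  rw [← augSpan.range_eq_span]
  have hNL : (N ⊓ L).toSubgroup ≤ L.toSubgroup := inf_le_right
  have hmap : L.toSubgroup.map (QuotientGroup.mk' (N ⊓ L).toSubgroup) ≤
      Subgroup.closure (QuotientGroup.mk' (N ⊓ L).toSubgroup '' Set.range e) := by
    rw [← MonoidHom.map_closure, ← sup_bot_eq (Subgroup.map _ (Subgroup.closure _)),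
      ← QuotientGroup.map_mk'_self (N ⊓ L).toSubgroup, ← Subgroup.map_sup]
    exact Subgroup.map_mono (he (N ⊓ L))
  have hle := (augSpan.mono (F := F) (σ := MonoidAlgebra.of F _) hmap).trans
    (augSpan.closure_le_mul_top _)
  have hx' : proj F (N ⊓ L) x ∈ augSpan F (MonoidAlgebra.of F (G ⧸ (N ⊓ L).toSubgroup))
      (QuotientGroup.mk' (N ⊓ L).toSubgroup '' Set.range e) * ⊤ :=
    Submodule.mul_le.mpr (fun _ hy z _ => mul_mem_mul_top (hle hy) z)
      (map_ker_proj_le (F := F) hNL (Submodule.mem_map_of_mem hx))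
  rw [← map_proj_augSpan_mul_top] at hx'
  obtain ⟨y, hy, hyx⟩ := hx'
  exact ⟨y, hy, proj_eq_of_le (N := N ⊓ L) inf_le_left hyx⟩

lemma finite_quotient_of_ker_proj_le {I : Submodule F (completedGroupAlgebra F G)}
    (hI : LinearMap.ker (proj F L).toLinearMap ≤ I) :
    Module.Finite F (completedGroupAlgebra F G ⧸ I) := by
  have := finite_monoidAlgebra_quotient (F := F) L
  have : Module.Finite F (completedGroupAlgebra F G ⧸ LinearMap.ker (proj F L).toLinearMap) :=
    Module.Finite.of_injective _
      (LinearMap.ker_eq_bot.mp (Submodule.ker_liftQ_eq_bot' _ (proj F L).toLinearMap rfl))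
  exact Module.Finite.of_surjective _ (Submodule.factor_surjective hI)

end Compact

end completedGroupAlgebra

/-- The open normal subgroups `U 0 ≥ U 1 ≥ …` of `G` behave like the lower `p`-series of a uniform
pro-`p` group: the `p ^ s`-th powers of the elements `e i` generate `U s` topologically, and the
commutators of the `e i` lie two steps down. -/
structure IsPowerFiltration (p : ℕ) {G ι : Type*} [Group G] [TopologicalSpace G]
    (U : ℕ → OpenNormalSubgroup G) (e : ι → G) : Prop where
  mem_zero : ∀ i, e i ∈ (U 0).toSubgroup
  pow_mem : ∀ s, ∀ g ∈ (U 0).toSubgroup, g ^ p ^ s ∈ (U s).toSubgroup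
  le_closure_sup : ∀ s (N : OpenNormalSubgroup G),
    (U s).toSubgroup ≤ Subgroup.closure (Set.range fun i => e i ^ p ^ s) ⊔ N.toSubgroup
  commutator_mem : ∀ i j, ⁅e i, e j⁆ ∈ (U 2).toSubgroup

namespace IsPowerFiltration

open completedGroupAlgebra

variable {p : ℕ} {G ι : Type*} [Group G] [TopologicalSpace G] {U : ℕ → OpenNormalSubgroup G}
  {e : ι → G} (hU : IsPowerFiltration p U e)

include hU

lemma le_zero (s : ℕ) : (U s).toSubgroup ≤ (U 0).toSubgroup :=
  (hU.le_closure_sup s (U 0)).trans <| sup_le ((Subgroup.closure_le _).mpr <| by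
    rintro _ ⟨i, rfl⟩
    exact (U 0).toSubgroup.pow_mem (hU.mem_zero i) _) le_rfl

lemma map_mk'_le_closure (s : ℕ) (N : OpenNormalSubgroup G) :
    (U s).toSubgroup.map (QuotientGroup.mk' N.toSubgroup) ≤
      Subgroup.closure (Set.range fun i => QuotientGroup.mk' N.toSubgroup (e i) ^ p ^ s) := by
  refine (Subgroup.map_mono (hU.le_closure_sup s N)).trans ?_
  rw [Subgroup.map_sup, QuotientGroup.map_mk'_self, sup_bot_eq, MonoidHom.map_closure,
    ← Set.range_comp]
  simp only [Function.comp_def, map_pow, le_refl]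

lemma closure_range_mk' (N : OpenNormalSubgroup G) :
    Subgroup.closure (Set.range fun i => QuotientGroup.mk' N.toSubgroup (e i)) =
      (U 0).toSubgroup.map (QuotientGroup.mk' N.toSubgroup) := by
  apply le_antisymm
  · rw [Subgroup.closure_le]
    rintro _ ⟨i, rfl⟩
    exact Subgroup.mem_map_of_mem _ (hU.mem_zero i)
  · simpa only [pow_zero, pow_one] using hU.map_mk'_le_closure 0 N

variable {F : Type*} [Field F]

variable (F) in
lemma ker_proj_pow_card_le [Finite F] [Fact p.Prime] [CharP F p] [IsTopologicalGroup G]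
    [CompactSpace G] [Fintype ι] (s : ℕ) :
    LinearMap.ker (proj F (U 0)).toLinearMap ^ (Fintype.card ι * (p ^ s - 1) + 1) ≤
      LinearMap.ker (proj F (U s)).toLinearMap := by
  have := finite_monoidAlgebra_quotient (F := F) (U s)
  have hs {g : G} (hg : g ∈ (U 0).toSubgroup) :
      QuotientGroup.mk' (U s).toSubgroup g ^ p ^ s = 1 :=
    (map_pow _ g _).symm.trans ((QuotientGroup.eq_one_iff _).mpr (hU.pow_mem s g hg))
  have hP : IsPGroup p (Subgroup.closure (Set.range fun i =>
      QuotientGroup.mk' (U s).toSubgroup (e i))) := by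
    rw [hU.closure_range_mk']
    rintro ⟨_, g, hg, rfl⟩
    exact ⟨s, Subtype.ext (hs hg)⟩
  have hcomm (i j : ι) : ⁅QuotientGroup.mk' (U s).toSubgroup (e i),
      QuotientGroup.mk' (U s).toSubgroup (e j)⁆ ∈ Subgroup.closure
        (Set.range fun i => QuotientGroup.mk' (U s).toSubgroup (e i) ^ p ^ 2) := by
    rw [← map_commutatorElement]
    exact hU.map_mk'_le_closure 2 _ (Subgroup.mem_map_of_mem _ (hU.commutator_mem i j))
  have hbot := augSpan.closure_range_pow_eq_bot (F := F)
    (σ := MonoidAlgebra.of F (G ⧸ (U s).toSubgroup)) hP hcomm fun i => hs (hU.mem_zero i)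
  have hmap := map_ker_proj_pow_le (F := F) (hU.le_zero s)
    (Fintype.card ι * (p ^ s - 1) + 1)
  rwa [← hU.closure_range_mk', hbot, Submodule.bot_mul, Submodule.map_le_iff_le_comap]
    at hmap

variable [Finite F] [IsTopologicalGroup G] [CompactSpace G] {T : Set G} {s : ℕ}
  (hT : ((U s).toSubgroup : Set G) ⊆ T)

include hT

lemma ker_proj_le_augSpan_mul_top [Finite ι] :
    LinearMap.ker (proj F (U s)).toLinearMap ≤ augSpan F (of F G) T * ⊤ := by
  have hsub : (Set.range fun i => e i ^ p ^ s) ⊆ T := by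
    rintro _ ⟨i, rfl⟩
    exact hT (hU.pow_mem s _ (hU.mem_zero i))
  exact (ker_proj_le_of_le_closure_sup (hU.le_closure_sup s)).trans
    (mul_le_mul_left (augSpan.mono hsub) _)

lemma finite_quotient_augSpan_mul_top [Finite ι] :
    Module.Finite F (completedGroupAlgebra F G ⧸ (augSpan F (of F G) T * ⊤)) :=
  finite_quotient_of_ker_proj_le (hU.ker_proj_le_augSpan_mul_top hT)

theorem ker_proj_pow_le_augSpan_mul_top [Fact p.Prime] [CharP F p] [Fintype ι] :
    LinearMap.ker (proj F (U 0)).toLinearMap ^ ((Fintype.card ι + 1) * p ^ s) ≤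
      augSpan F (of F G) T * ⊤ := by
  have hle : Fintype.card ι * (p ^ s - 1) + 1 ≤ (Fintype.card ι + 1) * p ^ s := by
    rw [add_mul, one_mul]
    exact add_le_add (Nat.mul_le_mul_left _ (Nat.sub_le _ _))
      (Nat.one_le_pow _ _ (Fact.out : p.Prime).pos)
  obtain ⟨t, ht⟩ := Nat.exists_eq_add_of_le hle
  rw [ht, pow_add]
  calc _ ≤ augSpan F (of F G) T * ⊤ * ⊤ :=
        mul_le_mul' ((hU.ker_proj_pow_card_le F s).trans (hU.ker_proj_le_augSpan_mul_top hT)) le_top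
    _ ≤ augSpan F (of F G) T * ⊤ := by
        rw [mul_assoc]; exact mul_le_mul_right le_top _

end IsPowerFiltration

section CoinvariantsGrowth

variable {p : ℕ} {P G ι ν : Type*} [Group P] [Group G] [TopologicalSpace G]
  {U : ℕ → OpenNormalSubgroup G} {e : ι → G} (hU : IsPowerFiltration p U e) {π : P →* G}
  {T : ν → Subgroup P} {s : ν → ℕ} (hT : ∀ n, ((U (s n)).toSubgroup : Set G) ⊆ π '' T n)
  {F : Type*} [Field F] [Finite F] [IsTopologicalGroup G] [CompactSpace G] [Finite ι]
  {M : Type*} [AddCommGroup M] [Module F M] [Module (completedGroupAlgebra F G) M]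
  [IsScalarTower F (completedGroupAlgebra F G) M] [Module.Finite (completedGroupAlgebra F G) M]
  {φ : Module.End (completedGroupAlgebra F G) M}

namespace IsPowerFiltration

open completedGroupAlgebra

include hU hT

variable (F) in
lemma finite_quotient_augSpan_comp_mul_top (n : ν) : Module.Finite F
    (completedGroupAlgebra F G ⧸ (augSpan F ((of F G).comp π) (T n) * ⊤)) := by
  rw [augSpan.comp]
  exact hU.finite_quotient_augSpan_mul_top (hT n)

variable (F) in
lemma ker_proj_pow_le_augSpan_comp_mul_top [Fact p.Prime] [CharP F p] (n : ν) :
    LinearMap.ker (proj F (U 0)).toLinearMap ^ ((Nat.card ι + 1) * p ^ s n) ≤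
      augSpan F ((of F G).comp π) (T n) * ⊤ := by
  have := Fintype.ofFinite ι
  rw [augSpan.comp, Nat.card_eq_fintype_card]
  exact hU.ker_proj_pow_le_augSpan_mul_top (hT n)

theorem finite_coinvariants (n : ν) :
    Module.Finite F (CoinvariantsVia F ((of F G).comp π) (T n) M) :=
  have := hU.finite_quotient_augSpan_comp_mul_top hT F n
  CoinvariantsVia.finite_of_finite_quotient_mul_top

theorem comparable_finrank_coinvariants (hφ : IsNilpotent φ) :
    Comparable (fun n => Module.finrank F (CoinvariantsVia F ((of F G).comp π) (T n) M))
      (fun n => Module.finrank F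
        (CoinvariantsVia F ((of F G).comp π) (T n) (M ⧸ LinearMap.range φ))) := by
  have := hU.finite_quotient_augSpan_comp_mul_top hT F
  exact CoinvariantsVia.comparable_finrank_quotient_range hφ

variable [Fact p.Prime] [CharP F p] (hφ : (⨅ k ≥ 1, LinearMap.range (φ ^ k)) = ⊥)

include hφ

theorem dominated_max_finrank_coinvariants_gradedPiece (k : ℕ) :
    Dominated (fun n => Module.finrank F (CoinvariantsVia F ((of F G).comp π) (T n) M))
      (fun n => max
        (Module.finrank F (CoinvariantsVia F ((of F G).comp π) (T n) (M ⧸ LinearMap.range φ)))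
        (p ^ s n * Module.finrank F
          (CoinvariantsVia F ((of F G).comp π) (T n) (gradedPiece φ k)))) := by
  have := hU.finite_quotient_augSpan_comp_mul_top hT F
  exact completedGroupAlgebra.dominated_max_finrank_coinvariants_gradedPiece
    (hU.ker_proj_pow_le_augSpan_comp_mul_top hT F) hφ k

theorem dominated_finrank_coinvariants_quotient_range :
    Dominated (fun n => Module.finrank F (CoinvariantsVia F ((of F G).comp π) (T n) M))
      (fun n => p ^ s n * Module.finrank F
        (CoinvariantsVia F ((of F G).comp π) (T n) (M ⧸ LinearMap.range φ))) := by
  have := hU.finite_quotient_augSpan_comp_mul_top hT F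
  exact completedGroupAlgebra.dominated_finrank_coinvariants_quotient_range
    (hU.ker_proj_pow_le_augSpan_comp_mul_top hT F) hφ

end IsPowerFiltration

end CoinvariantsGrowth

section LeadingTerms

variable {S : Type*} [Ring S]

lemma natCast_dvd_mul_left {a : ℕ} {x : S} (hx : (a : S) ∣ x) (y : S) : (a : S) ∣ y * x := by
  obtain ⟨z, rfl⟩ := hx
  exact ⟨y * z, by rw [← mul_assoc, ← mul_assoc, (Nat.cast_commute a y).eq]⟩

lemma natCast_mul_dvd_mul {a b : ℕ} {x y : S} (hx : (a : S) ∣ x) (hy : (b : S) ∣ y) :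
    ((a * b : ℕ) : S) ∣ x * y := by
  obtain ⟨x, rfl⟩ := hx
  obtain ⟨y, rfl⟩ := hy
  exact ⟨x * y, by rw [Nat.cast_mul, mul_assoc, mul_assoc, ← mul_assoc x,
    (Nat.cast_commute b x).symm.eq, mul_assoc]⟩

variable (S) in
/-- The principal congruence subgroup of level `a` of the group of units of a ring: the units
congruent to `1` modulo `a`. -/
def principalCongr (a : ℕ) : Subgroup Sˣ where
  carrier := {g | (a : S) ∣ g - 1}
  one_mem' := by simp
  mul_mem' {g h} hg hh := by
    have : ((g * h : Sˣ) : S) - 1 = g * (h - 1) + (g - 1) := by rw [Units.val_mul]; noncomm_ring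
    rw [Set.mem_ofPred_eq, this]
    exact dvd_add (natCast_dvd_mul_left hh _) hg
  inv_mem' {g} hg := by
    have : ((g⁻¹ : Sˣ) : S) - 1 = -(↑g⁻¹ * (g - 1)) := by
      rw [mul_sub, Units.inv_mul, mul_one, neg_sub]
    rw [Set.mem_ofPred_eq, this]
    exact (natCast_dvd_mul_left hg _).neg_right

lemma mem_principalCongr {a : ℕ} {g : Sˣ} : g ∈ principalCongr S a ↔ (a : S) ∣ g - 1 := Iff.rfl

instance principalCongr.normal (a : ℕ) : (principalCongr S a).Normal where
  conj_mem g hg h := by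
    have : ((h * g * h⁻¹ : Sˣ) : S) - 1 = h * (g - 1) * ↑h⁻¹ := by
      rw [mul_sub, sub_mul, mul_one, Units.mul_inv, Units.val_mul, Units.val_mul]
    rw [mem_principalCongr, this]
    exact (natCast_dvd_mul_left hg _).mul_right _

lemma principalCongr_anti {a b : ℕ} (h : a ∣ b) : principalCongr S b ≤ principalCongr S a :=
  fun _ hg => ((Nat.castRingHom S).map_dvd h).trans hg

lemma commutator_principalCongr_mem {a b : ℕ} {g h : Sˣ} (hg : g ∈ principalCongr S a)
    (hh : h ∈ principalCongr S b) : ⁅g, h⁆ ∈ principalCongr S (a * b) := by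
  have hcomm : ((⁅g, h⁆ : Sˣ) : S) - 1 =
      (((g : S) - 1) * (h - 1) - (h - 1) * (g - 1)) * ↑(h * g)⁻¹ := by
    have : ((g : S) - 1) * (h - 1) - (h - 1) * (g - 1) = ↑(g * h) - ↑(h * g) := by
      rw [Units.val_mul, Units.val_mul]; noncomm_ring
    rw [this, sub_mul, Units.mul_inv, ← Units.val_mul, commutatorElement_def, mul_inv_rev]
    simp only [mul_assoc]
  rw [mem_principalCongr, hcomm]
  exact (dvd_sub (natCast_mul_dvd_mul hg hh) (mul_comm b a ▸ natCast_mul_dvd_mul hh hg)).mul_right _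

lemma exists_one_add_pow_eq (x : S) (l : ℕ) :
    ∃ y, (1 + x) ^ l = 1 + l * x + x ^ 2 * y := by
  induction l with
  | zero => exact ⟨0, by simp⟩
  | succ l ih =>
    obtain ⟨y, hy⟩ := ih
    refine ⟨y * (1 + x) + l, ?_⟩
    have hl : (l : S) * x * x = x ^ 2 * l := by rw [mul_assoc, ← sq, (Nat.cast_commute l _).eq]
    rw [pow_succ, hy, Nat.cast_succ, add_mul, mul_add (1 + (l : S) * x), mul_one, add_mul 1,
      one_mul, hl]
    noncomm_ring

/-- `g = 1 + p ^ m A + …`, the dots standing for a multiple of `p ^ (m + 1)`. -/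
def IsLeadingTerm (p m : ℕ) (A : S) (g : Sˣ) : Prop :=
  ((p ^ (m + 1) : ℕ) : S) ∣ g - 1 - (p ^ m : ℕ) * A

namespace IsLeadingTerm

variable {p m : ℕ} {A B : S} {g h : Sˣ}

lemma mem_principalCongr (hg : IsLeadingTerm p m A g) : g ∈ principalCongr S (p ^ m) := by
  have hdvd : ((p ^ m : ℕ) : S) ∣ (p ^ (m + 1) : ℕ) :=
    (Nat.castRingHom S).map_dvd (pow_dvd_pow p m.le_succ)
  exact (dvd_sub_left (dvd_mul_right _ A)).mp (hdvd.trans hg)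

lemma one_of_dvd (hA : (p : S) ∣ A) : IsLeadingTerm p m A 1 := by
  obtain ⟨A, rfl⟩ := hA
  exact ⟨-A, by push_cast; noncomm_ring⟩

lemma mul (hm : m ≠ 0) (hg : IsLeadingTerm p m A g) (hh : IsLeadingTerm p m B h) :
    IsLeadingTerm p m (A + B) (g * h) := by
  have hmul : ((p ^ (m + 1) : ℕ) : S) ∣ ((g : S) - 1) * (h - 1) :=
    ((Nat.castRingHom S).map_dvd (by
      rw [← pow_add]; exact pow_dvd_pow p (by omega))).trans
      (natCast_mul_dvd_mul hg.mem_principalCongr hh.mem_principalCongr)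
  have heq : ((g * h : Sˣ) : S) - 1 - (p ^ m : ℕ) * (A + B) =
      (g - 1) * (h - 1) + (g - 1 - (p ^ m : ℕ) * A) + (h - 1 - (p ^ m : ℕ) * B) := by
    rw [Units.val_mul]; noncomm_ring
  rw [IsLeadingTerm, heq]
  exact dvd_add (dvd_add hmul hg) hh

/-- In `(1 + x) ^ p = 1 + p x + x ^ 2 y` the last term is divisible by `p ^ (2 m)`. -/
lemma pow_prime (hm : 2 ≤ m) (hg : IsLeadingTerm p m A g) :
    IsLeadingTerm p (m + 1) A (g ^ p) := by
  obtain ⟨y, hy⟩ := exists_one_add_pow_eq ((g : S) - 1) p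
  rw [add_sub_cancel] at hy
  have hsq : ((p ^ (m + 1 + 1) : ℕ) : S) ∣ ((g : S) - 1) ^ 2 := by
    rw [sq]
    exact ((Nat.castRingHom S).map_dvd (by
      rw [← pow_add]; exact pow_dvd_pow p (by omega))).trans
      (natCast_mul_dvd_mul hg.mem_principalCongr hg.mem_principalCongr)
  have hlin : ((p ^ (m + 1 + 1) : ℕ) : S) ∣ p * (g - 1 - (p ^ m : ℕ) * A) := by
    rw [pow_succ' p (m + 1)]
    exact natCast_mul_dvd_mul dvd_rfl hg
  have heq : ((g ^ p : Sˣ) : S) - 1 - (p ^ (m + 1) : ℕ) * A =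
      p * (g - 1 - (p ^ m : ℕ) * A) + (g - 1) ^ 2 * y := by
    rw [Units.val_pow_eq_pow_val, hy, pow_succ' p m, Nat.cast_mul p, mul_sub (p : S) (g - 1),
      mul_assoc]
    abel
  rw [IsLeadingTerm, heq]
  exact dvd_add hlin (hsq.mul_right y)

lemma pow_prime_pow (hm : 2 ≤ m) (hg : IsLeadingTerm p m A g) (s : ℕ) :
    IsLeadingTerm p (m + s) A (g ^ p ^ s) := by
  induction s with
  | zero => simpa only [pow_zero, pow_one, add_zero] using hg
  | succ s ih => rw [pow_succ, pow_mul]; exact ih.pow_prime (hm.trans (Nat.le_add_right _ _))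

end IsLeadingTerm

lemma exists_isLeadingTerm_of_mem_principalCongr {p m : ℕ} {g : Sˣ}
    (hg : g ∈ principalCongr S (p ^ m)) : ∃ A, IsLeadingTerm p m A g := by
  obtain ⟨A, hA⟩ := hg
  exact ⟨A, by rw [IsLeadingTerm, hA, sub_self]; exact dvd_zero _⟩

lemma pow_mem_principalCongr {p m : ℕ} (hm : 2 ≤ m) {g : Sˣ} (hg : g ∈ principalCongr S (p ^ m))
    (s : ℕ) : g ^ p ^ s ∈ principalCongr S (p ^ (m + s)) :=
  let ⟨_, hA⟩ := exists_isLeadingTerm_of_mem_principalCongr hg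
  (hA.pow_prime_pow hm s).mem_principalCongr

/-- The possible leading terms `A` of the elements `1 + p ^ m A + …` of a subgroup. -/
def leadingTerms (p : ℕ) {m : ℕ} (hm : m ≠ 0) (H : Subgroup Sˣ) : AddSubmonoid S where
  carrier := {A | ∃ h ∈ H, IsLeadingTerm p m A h}
  zero_mem' := ⟨1, one_mem H, .one_of_dvd (dvd_zero _)⟩
  add_mem' := fun ⟨g, hgH, hg⟩ ⟨h, hhH, hh⟩ => ⟨g * h, mul_mem hgH hhH, hg.mul hm hh⟩

lemma principalCongr_le_of_leadingTerms_eq_top {p m : ℕ} (hm : m ≠ 0) {H : Subgroup Sˣ}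
    (hH : principalCongr S (p ^ (m + 1)) ≤ H) (htop : leadingTerms p hm H = ⊤) :
    principalCongr S (p ^ m) ≤ H := by
  intro g hg
  obtain ⟨A, hA⟩ := exists_isLeadingTerm_of_mem_principalCongr hg
  obtain ⟨h, hhH, hh⟩ : A ∈ leadingTerms p hm H := htop ▸ AddSubmonoid.mem_top A
  have hgh : h⁻¹ * g ∈ principalCongr S (p ^ (m + 1)) := by
    have heq : ((h⁻¹ * g : Sˣ) : S) - 1 =
        ↑h⁻¹ * ((g - 1 - (p ^ m : ℕ) * A) - (h - 1 - (p ^ m : ℕ) * A)) := by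
      rw [sub_sub_sub_cancel_right, sub_sub_sub_cancel_right, mul_sub, Units.inv_mul,
        Units.val_mul]
    rw [mem_principalCongr, heq]
    exact natCast_dvd_mul_left (dvd_sub hA hh) _
  simpa only [mul_inv_cancel_left] using mul_mem hhH (hH hgh)

theorem principalCongr_le_of_pow_mem {p : ℕ} {ι : Type*} {A : ι → S} {γ : ι → Sˣ}
    (hγ : ∀ i, IsLeadingTerm p 2 (A i) (γ i))
    (hA : AddSubmonoid.closure (Set.range A ∪ {B | (p : S) ∣ B}) = ⊤) {H : Subgroup Sˣ} {N s : ℕ}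
    (hN : principalCongr S (p ^ N) ≤ H) (hs : ∀ i, γ i ^ p ^ s ∈ H) :
    principalCongr S (p ^ (2 + s)) ≤ H := by
  rcases le_total N (2 + s) with h | h
  · exact (principalCongr_anti (pow_dvd_pow p h)).trans hN
  refine Nat.decreasingInduction' (P := fun m => principalCongr S (p ^ m) ≤ H)
    (fun m _ hm ih => ?_) h hN
  have hm0 : m ≠ 0 := by omega
  refine principalCongr_le_of_leadingTerms_eq_top hm0 ih (eq_top_iff.mpr ?_)
  rw [← hA, AddSubmonoid.closure_le]
  obtain ⟨t, rfl⟩ := Nat.exists_eq_add_of_le hm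
  rintro _ (⟨i, rfl⟩ | hB)
  · refine ⟨γ i ^ p ^ (s + t), ?_, by simpa only [add_assoc] using (hγ i).pow_prime_pow le_rfl _⟩
    rw [pow_add, pow_mul]
    exact pow_mem (hs i) _
  · exact ⟨1, one_mem H, .one_of_dvd hB⟩

end LeadingTerms

section PadicMatrices

variable {p : ℕ} [Fact p.Prime] {ι n : Type*} [Fintype n] [DecidableEq n]

lemma natCast_dvd_matrix_iff {R : Type*} [Ring R] {a : ℕ} {A : Matrix n n R} :
    (a : Matrix n n R) ∣ A ↔ ∀ i j, (a : R) ∣ A i j := by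
  constructor
  · rintro ⟨B, rfl⟩ i j
    exact ⟨B i j, by rw [← nsmul_eq_mul, ← nsmul_eq_mul, Matrix.smul_apply]⟩
  · intro h
    choose B hB using h
    refine ⟨Matrix.of B, ?_⟩
    ext i j
    rw [← nsmul_eq_mul, Matrix.smul_apply, Matrix.of_apply, hB, nsmul_eq_mul]

lemma isUnit_of_dvd_sub_one {A : ι → Matrix n n ℤ_[p]}
    (hA : (p : ι → Matrix n n ℤ_[p]) ∣ A - 1) : IsUnit A := by
  rw [Pi.isUnit_iff]
  intro i
  have hmod : PadicInt.toZMod.mapMatrix (A i) = 1 := by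
    obtain ⟨B, hB⟩ := hA
    have hp : (p : Matrix n n (ZMod p)) = 0 := by
      rw [← map_natCast (algebraMap (ZMod p) _), CharP.cast_eq_zero, map_zero]
    have hi : A i - 1 = p * B i := congrFun hB i
    rw [← sub_eq_zero, ← map_one (PadicInt.toZMod (p := p)).mapMatrix, ← map_sub, hi, map_mul,
      map_natCast, hp, zero_mul]
  rw [Matrix.isUnit_iff_isUnit_det]
  by_contra hdet
  have hzero : (A i).det ∈ RingHom.ker (PadicInt.toZMod (p := p)) :=
    PadicInt.ker_toZMod (p := p) ▸ hdet
  rw [RingHom.mem_ker, RingHom.map_det, hmod, Matrix.det_one] at hzero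
  exact one_ne_zero hzero

lemma addSubmonoidClosure_single_union_dvd_eq_top [Finite ι] [DecidableEq ι] :
    AddSubmonoid.closure
      (Set.range (fun x : ι × n × n => Pi.single x.1 (Matrix.single x.2.1 x.2.2 1)) ∪
        {B : ι → Matrix n n ℤ_[p] | (p : ι → Matrix n n ℤ_[p]) ∣ B}) = ⊤ := by
  refine eq_top_iff.mpr fun B _ => AddSubmonoid.pi_mem_of_single_mem B fun i => ?_
  rw [Matrix.matrix_eq_sum_single (B i), ← AddMonoidHom.single_apply, map_sum]
  refine sum_mem fun j _ => ?_
  rw [map_sum]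
  refine sum_mem fun k _ => ?_
  obtain ⟨c, hc⟩ := Ideal.mem_span_singleton.mp (PadicInt.appr_spec 1 (B i j k))
  rw [pow_one] at hc
  have hB : Matrix.single j k (B i j k) =
      (B i j k).appr 1 • Matrix.single j k 1 + (p : Matrix n n ℤ_[p]) * Matrix.single j k c := by
    rw [← nsmul_eq_mul, Matrix.smul_single, Matrix.smul_single, ← Matrix.single_add, nsmul_one,
      nsmul_eq_mul, ← hc, add_sub_cancel]
  rw [hB, map_add, map_nsmul]
  refine add_mem (nsmul_mem (AddSubmonoid.subset_closure (.inl ⟨(i, j, k), rfl⟩)) _)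
    (AddSubmonoid.subset_closure (.inr ⟨Pi.single i (Matrix.single j k c), ?_⟩))
  rw [AddMonoidHom.single_apply, ← nsmul_eq_mul, ← nsmul_eq_mul, Pi.single_smul]

lemma isUnit_one_add_sq_mul (A : ι → Matrix n n ℤ_[p]) : IsUnit (1 + ((p ^ 2 : ℕ) : _) * A) :=
  isUnit_of_dvd_sub_one ⟨p * A, by rw [add_sub_cancel_left, sq, Nat.cast_mul, mul_assoc]⟩

variable (p) in
/-- The elements `1 + p ^ 2 E` of `∏ GL_n(ℤ_p)`, where `E` runs over the elementary matrices in the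
factors. -/
noncomputable def congrGen [DecidableEq ι] (x : ι × n × n) : (ι → Matrix n n ℤ_[p])ˣ :=
  (isUnit_one_add_sq_mul (Pi.single x.1 (Matrix.single x.2.1 x.2.2 1))).unit

lemma isLeadingTerm_congrGen [DecidableEq ι] (x : ι × n × n) :
    IsLeadingTerm p 2 (Pi.single x.1 (Matrix.single x.2.1 x.2.2 1)) (congrGen p x) := by
  rw [IsLeadingTerm, congrGen, IsUnit.unit_spec, add_sub_cancel_left, sub_self]
  exact dvd_zero _

lemma isOpen_setOf_natCast_pow_dvd (N : ℕ) :
    IsOpen {A : Matrix n n ℤ_[p] | ((p ^ N : ℕ) : Matrix n n ℤ_[p]) ∣ A} := by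
  simp only [natCast_dvd_matrix_iff, Set.ofPred_forall]
  refine isOpen_iInter_of_finite fun i => isOpen_iInter_of_finite fun j => ?_
  have hball : {A : Matrix n n ℤ_[p] | ((p ^ N : ℕ) : ℤ_[p]) ∣ A i j} =
      (fun A => A i j) ⁻¹' Metric.closedBall 0 ((p : ℝ) ^ (-(N : ℤ))) := by
    ext A
    rw [Set.mem_preimage, mem_closedBall_zero_iff, PadicInt.norm_le_pow_iff_mem_span_pow,
      Ideal.mem_span_singleton, ← Nat.cast_pow]
    rfl
  rw [hball]
  exact (IsUltrametricDist.isOpen_closedBall _ (zpow_ne_zero _ (Nat.cast_ne_zero.mpr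
    (Fact.out : p.Prime).ne_zero))).preimage (continuous_id.matrix_elem i j)

lemma isOpen_principalCongr (N : ℕ) :
    IsOpen (principalCongr (Matrix n n ℤ_[p]) (p ^ N) : Set (Matrix n n ℤ_[p])ˣ) :=
  (isOpen_setOf_natCast_pow_dvd N).preimage (Units.continuous_val.sub continuous_const)

lemma eq_one_of_forall_mem_principalCongr {g : (Matrix n n ℤ_[p])ˣ}
    (hg : ∀ N, g ∈ principalCongr (Matrix n n ℤ_[p]) (p ^ N)) : g = 1 := by
  refine Units.ext (Matrix.ext fun i j => PadicInt.ext_of_toZModPow.mp fun N => ?_)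
  rw [← sub_eq_zero, ← map_sub, ← RingHom.mem_ker, PadicInt.ker_toZModPow, Ideal.mem_span_singleton,
    ← Nat.cast_pow]
  exact natCast_dvd_matrix_iff.mp (hg N) i j

end PadicMatrices

section ProdK1

variable {p : ℕ} [Fact p.Prime] {r : ℕ}

lemma K1_eq_principalCongr : K1 p = principalCongr (Matrix (Fin 2) (Fin 2) ℤ_[p]) p := by
  ext g
  rw [K1, MonoidHom.mem_ker, Matrix.GeneralLinearGroup.ext_iff, mem_principalCongr,
    natCast_dvd_matrix_iff]
  refine forall₂_congr fun i j => ?_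
  rw [Matrix.GeneralLinearGroup.map_apply, Matrix.sub_apply, ← Ideal.mem_span_singleton,
    ← Ideal.Quotient.eq_zero_iff_mem, map_sub, sub_eq_zero]
  rcases eq_or_ne i j with rfl | h
  · simp
  · simp [h]

lemma principalCongr_le_T1 (n : ℕ+) :
    principalCongr (Matrix (Fin 2) (Fin 2) ℤ_[p]) (p ^ (n : ℕ)) ≤ T1 p n := by
  intro g hg
  have hentry := natCast_dvd_matrix_iff.mp hg
  have hp : (p : ℤ_[p]) ∣ p ^ (n : ℕ) := dvd_pow_self _ n.ne_zero
  push_cast at hentry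
  exact ⟨hp.trans (hentry 0 0), by simpa using hentry 0 1, by simpa using hentry 1 0,
    hp.trans (hentry 1 1)⟩

instance instCompactSpaceProdK1 : CompactSpace (ProdK1 p r) := by
  have : CompactSpace (Matrix (Fin 2) (Fin 2) ℤ_[p]) :=
    inferInstanceAs (CompactSpace (Fin 2 → Fin 2 → ℤ_[p]))
  have hclosed : IsClosed (K1 p : Set (GL (Fin 2) ℤ_[p])) := by
    rw [K1_eq_principalCongr]
    exact Subgroup.isClosed_of_isOpen _ (by simpa only [pow_one] using isOpen_principalCongr 1)
  have : CompactSpace (K1 p) := isCompact_iff_compactSpace.mp hclosed.isCompact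
  infer_instance

variable (p r) in
/-- The embedding of `𝒦₁` in the group of units of the product of `r` copies of `M₂(ℤ_p)`. -/
noncomputable def prodK1Units : ProdK1 p r →* (Fin r → Matrix (Fin 2) (Fin 2) ℤ_[p])ˣ :=
  MulEquiv.piUnits.symm.toMonoidHom.comp (MonoidHom.piMap fun _ => (K1 p).subtype)

lemma prodK1Units_injective : Function.Injective (prodK1Units p r) :=
  MulEquiv.piUnits.symm.injective.comp fun _ _ h => funext fun i => Subtype.ext (congrFun h i)

lemma prodK1Units_mem_principalCongr {N : ℕ} {g : ProdK1 p r} :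
    prodK1Units p r g ∈ principalCongr _ N ↔
      ∀ i, (g i : GL (Fin 2) ℤ_[p]) ∈ principalCongr _ N :=
  pi_dvd_iff

lemma range_prodK1Units : (prodK1Units p r).range = principalCongr _ p := by
  ext g
  constructor
  · rintro ⟨g, rfl⟩
    exact prodK1Units_mem_principalCongr.mpr fun i => K1_eq_principalCongr.le (g i).2
  · intro hg
    exact ⟨fun i => ⟨MulEquiv.piUnits g i, K1_eq_principalCongr.ge (pi_dvd_iff.mp hg i)⟩,
      MulEquiv.piUnits.symm_apply_apply g⟩

variable (p r) in
/-- The principal congruence subgroup of level `p ^ N` of `𝒦₁`. -/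
noncomputable def prodCongr (N : ℕ) : Subgroup (ProdK1 p r) :=
  (principalCongr _ (p ^ N)).comap (prodK1Units p r)

instance prodCongr.normal (N : ℕ) : (prodCongr p r N).Normal :=
  (principalCongr.normal _).comap _

lemma prodCongr_le_ProdT1 {n : Fin r → ℕ+} {N : ℕ} (hN : kappa n ≤ N) :
    prodCongr p r N ≤ ProdT1 p n := fun _ hg i _ =>
  principalCongr_le_T1 (n i) (principalCongr_anti (pow_dvd_pow p
    ((Finset.le_sup (f := fun i => (n i : ℕ)) (Finset.mem_univ i)).trans hN))
    (prodK1Units_mem_principalCongr.mp hg i))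

lemma isOpen_prodCongr (N : ℕ) : IsOpen (prodCongr p r N : Set (ProdK1 p r)) := by
  have : (prodCongr p r N : Set (ProdK1 p r)) = ⋂ i, (fun g => (g i : GL (Fin 2) ℤ_[p])) ⁻¹'
      (principalCongr (Matrix (Fin 2) (Fin 2) ℤ_[p]) (p ^ N)) := by
    ext g
    rw [Set.mem_iInter]
    exact prodK1Units_mem_principalCongr
  rw [this]
  exact isOpen_iInter_of_finite fun i => (isOpen_principalCongr N).preimage
    (continuous_subtype_val.comp (continuous_apply i))

lemma exists_prodCongr_subset {U : Set (ProdK1 p r)} (hU : U ∈ nhds 1) :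
    ∃ N, (prodCongr p r N : Set (ProdK1 p r)) ⊆ U := by
  have hanti : Antitone fun N => (prodCongr p r N : Set (ProdK1 p r)) := fun _ _ h =>
    Subgroup.comap_mono (principalCongr_anti (pow_dvd_pow p h))
  refine exists_subset_nhds_of_compactSpace hanti.directed_ge
    (fun N => Subgroup.isClosed_of_isOpen _ (isOpen_prodCongr N)) fun g hg => ?_
  suffices g = 1 from this ▸ hU
  exact funext fun i => Subtype.ext <| eq_one_of_forall_mem_principalCongr fun N =>
    prodK1Units_mem_principalCongr.mp (Set.mem_iInter.mp hg N) i

lemma exists_prodK1Units_eq_congrGen (x : Fin r × Fin 2 × Fin 2) :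
    ∃ g : ProdK1 p r, prodK1Units p r g = congrGen p x := by
  rw [← MonoidHom.mem_range, range_prodK1Units]
  exact principalCongr_anti (dvd_pow_self p two_ne_zero)
    (isLeadingTerm_congrGen x).mem_principalCongr

variable (p) in
/-- The elements `1 + p ^ 2 E` of `𝒦₁`, where `E` runs over the elementary matrices in the
factors. -/
noncomputable def prodGen (x : Fin r × Fin 2 × Fin 2) : ProdK1 p r :=
  (exists_prodK1Units_eq_congrGen x).choose

lemma prodK1Units_prodGen (x : Fin r × Fin 2 × Fin 2) :
    prodK1Units p r (prodGen p x) = congrGen p x :=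
  (exists_prodK1Units_eq_congrGen x).choose_spec

lemma prodGen_mem_prodCongr (x : Fin r × Fin 2 × Fin 2) : prodGen p x ∈ prodCongr p r 2 := by
  rw [prodCongr, Subgroup.mem_comap, prodK1Units_prodGen]
  exact (isLeadingTerm_congrGen x).mem_principalCongr

lemma pow_mem_prodCongr {g : ProdK1 p r} (hg : g ∈ prodCongr p r 2) (s : ℕ) :
    g ^ p ^ s ∈ prodCongr p r (2 + s) := by
  rw [prodCongr, Subgroup.mem_comap, map_pow]
  exact pow_mem_principalCongr le_rfl hg s

lemma commutator_prodCongr_mem {g h : ProdK1 p r} {a b : ℕ} (hg : g ∈ prodCongr p r a)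
    (hh : h ∈ prodCongr p r b) : ⁅g, h⁆ ∈ prodCongr p r (a + b) := by
  rw [prodCongr, Subgroup.mem_comap, map_commutatorElement, pow_add]
  exact commutator_principalCongr_mem hg hh

theorem prodCongr_le_of_pow_prodGen_mem {H : Subgroup (ProdK1 p r)} {N s : ℕ}
    (hN : prodCongr p r N ≤ H) (hs : ∀ x, prodGen p x ^ p ^ s ∈ H) :
    prodCongr p r (2 + s) ≤ H := by
  have hle : principalCongr _ (p ^ (N + 1)) ≤ H.map (prodK1Units p r) := by
    intro g hg
    obtain ⟨g, rfl⟩ := range_prodK1Units.ge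
      (principalCongr_anti (dvd_pow_self p N.succ_ne_zero) hg)
    exact Subgroup.mem_map_of_mem _ (hN (principalCongr_anti (pow_dvd_pow p N.le_succ) hg))
  have hmem (x) : congrGen p x ^ p ^ s ∈ H.map (prodK1Units p r) := by
    rw [← prodK1Units_prodGen, ← map_pow]
    exact Subgroup.mem_map_of_mem _ (hs x)
  rw [← Subgroup.comap_map_eq_self_of_injective prodK1Units_injective H]
  exact Subgroup.comap_mono (principalCongr_le_of_pow_mem isLeadingTerm_congrGen
    addSubmonoidClosure_single_union_dvd_eq_top hle hmem)

variable (p r) in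
/-- The image of the congruence subgroup of level `p ^ N` in `𝒦₁/𝒵₁`. -/
noncomputable def quotCongr (N : ℕ) : OpenNormalSubgroup (ProdK1 p r ⧸ ProdZ1 p r) where
  toSubgroup := (prodCongr p r N).map (QuotientGroup.mk' (ProdZ1 p r))
  isOpen' := QuotientGroup.isOpenMap_coe _ (isOpen_prodCongr N)
  isNormal' := (prodCongr.normal N).map _ (QuotientGroup.mk'_surjective _)

/-- Level `p ^ 2` rather than `p` makes this true also for `p = 2`. -/
theorem isPowerFiltration_quotCongr : IsPowerFiltration p (fun s => quotCongr p r (2 + s))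
    fun x => QuotientGroup.mk' (ProdZ1 p r) (prodGen p x) where
  mem_zero x := Subgroup.mem_map_of_mem _ (prodGen_mem_prodCongr x)
  pow_mem := by
    rintro s _ ⟨g, hg, rfl⟩
    rw [← map_pow]
    exact Subgroup.mem_map_of_mem _ (pow_mem_prodCongr hg s)
  le_closure_sup s N := by
    obtain ⟨m, hm⟩ := exists_prodCongr_subset ((N.isOpen'.preimage
      QuotientGroup.continuous_mk).mem_nhds (one_mem N.toSubgroup))
    refine Subgroup.map_le_iff_le_comap.mpr (prodCongr_le_of_pow_prodGen_mem (N := m)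
      (fun g hg => Subgroup.mem_sup_right (hm hg)) fun x => Subgroup.mem_sup_left ?_)
    exact Subgroup.subset_closure ⟨x, (map_pow _ _ _).symm⟩
  commutator_mem x y := by
    rw [← map_commutatorElement]
    exact Subgroup.mem_map_of_mem _
      (commutator_prodCongr_mem (prodGen_mem_prodCongr x) (prodGen_mem_prodCongr y))

end ProdK1

lemma quotCongr_subset_image_ProdT1 {p : ℕ} [Fact p.Prime] {r : ℕ} (n : Fin r → ℕ+) :
    ((quotCongr p r (2 + kappa n)).toSubgroup : Set (ProdK1 p r ⧸ ProdZ1 p r)) ⊆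
      QuotientGroup.mk' (ProdZ1 p r) '' ProdT1 p n :=
  Set.image_mono (f := QuotientGroup.mk' (ProdZ1 p r))
    (prodCongr_le_ProdT1 (Nat.le_add_left (kappa n) 2))

theorem mainTheorem8_general (p : ℕ) [Fact p.Prime] (r : ℕ) (F : Type*) [Field F] [Finite F]
    [CharP F p] (M : Type*) [AddCommGroup M] [Module F M] [Module (Lam F p r) M]
    [IsScalarTower F (Lam F p r) M] [Module.Finite (Lam F p r) M]
    (φ : Module.End (Lam F p r) M)
    (hφ : (⨅ k ≥ 1, LinearMap.range (φ ^ k)) = ⊥) :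
    (∀ n : Fin r → ℕ+, Module.Finite F (coinv F p M n)) ∧
    (IsNilpotent φ →
      Comparable (fun n : Fin r → ℕ+ => dimCoinv F p M n)
        (fun n => dimCoinv F p (M ⧸ LinearMap.range φ) n)) ∧
    (∀ k, Dominated (fun n : Fin r → ℕ+ => dimCoinv F p M n)
      (fun n => max (dimCoinv F p (M ⧸ LinearMap.range φ) n)
        (p ^ kappa n * dimCoinv F p (gradedPiece φ k) n))) ∧
    Dominated (fun n : Fin r → ℕ+ => dimCoinv F p M n)
      (fun n => p ^ kappa n * dimCoinv F p (M ⧸ LinearMap.range φ) n) :=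
  ⟨isPowerFiltration_quotCongr.finite_coinvariants quotCongr_subset_image_ProdT1,
    isPowerFiltration_quotCongr.comparable_finrank_coinvariants quotCongr_subset_image_ProdT1,
    isPowerFiltration_quotCongr.dominated_max_finrank_coinvariants_gradedPiece
      quotCongr_subset_image_ProdT1 hφ,
    isPowerFiltration_quotCongr.dominated_finrank_coinvariants_quotient_range
      quotCongr_subset_image_ProdT1 hφ⟩

theorem mainTheorem8 (p : ℕ) [Fact p.Prime] (hp : 5 ≤ p) (r : ℕ) (hr : 1 ≤ r)
    (F : Type*) [Field F] [Finite F] [CharP F p]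
    (M : Type*) [AddCommGroup M] [Module F M] [Module (Lam F p r) M]
    [IsScalarTower F (Lam F p r) M] [Module.Finite (Lam F p r) M]
    (φ : Module.End (Lam F p r) M)
    (hφ : (⨅ k ≥ 1, LinearMap.range (φ ^ k)) = ⊥) :
    (∀ n : Fin r → ℕ+, Module.Finite F (coinv F p M n)) ∧
    (IsNilpotent φ →
      Comparable (fun n : Fin r → ℕ+ => dimCoinv F p M n)
        (fun n => dimCoinv F p (M ⧸ LinearMap.range φ) n)) ∧
    (¬ IsNilpotent φ →
      ∃ k₁ : ℕ, ∀ k₀ ≥ k₁,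
        Dominated (fun n : Fin r → ℕ+ => dimCoinv F p M n)
          (fun n => max (dimCoinv F p (M ⧸ LinearMap.range φ) n)
            (p ^ kappa n * dimCoinv F p (gradedPiece φ k₀) n))) ∧
    Dominated (fun n : Fin r → ℕ+ => dimCoinv F p M n)
      (fun n => p ^ kappa n * dimCoinv F p (M ⧸ LinearMap.range φ) n) := by
  have h := mainTheorem8_general p r F M φ hφ
  exact ⟨h.1, h.2.1, fun _ => ⟨0, fun k₀ _ => h.2.2.1 k₀⟩, h.2.2.2⟩
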